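/- Let $n\ge 1$ and $k\ge 1$ be integers and let $0=x_{-k}=\cdots=x_0<x_1<\cdots<x_n=\cdots=x_{n+k}=1$ be an extended knot sequence. For $j\in\{-k,\dots,n-1\}$ let $$N_{j,k}(t)=(x_{j+k+1}-x_j)\,[x_j,\dots,x_{j+k+1}](\cdot-t)_+^k ,\qquad t\in[0,1],$$ be the normalized B-splines of degree $k$, where $[x_j,\dots,x_{j+k+1}]$ denotes the divided difference and $s_+^k$ is $s^k$ for $s>0$ and $0$ otherwise. Let $$\xi_{j,k+1}=\frac{x_{j+1}+\cdots+x_{j+k+1}}{k+1}\qquad (-k-1\le j\le n-1)$$ be the Greville nodes, and let $M_{j,k}=N_{j,k}/(\xi_{j,k+1}-\xi_{j-1,k+1})$ be the B-splines normalized to have integral one. Then the $(n+k)\times(n+k)$ matrix $$A=\left(\int_{\xi_{i-1,k+1}}^{\xi_{i,k+1}} M_{j,k}(t)\,dt\right)_{i,j=-k}^{n-1}$$ is oscillatory, i.e. all its minors are nonnegative and for some integer $m\ge 1$ all minors of $A^m$ are positive. Moreover, all eigenvalues of $A$ are positive real numbers and they are distinct: the characteristic polynomial of $A$ is $\prod_{i=1}^{n+k}(X-\lambda_i)$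 with real numbers $\lambda_1>\lambda_2>\cdots>\lambda_{n+k}>0$, and $\{\lambda_1,\dots,\lambda_{n+k}\}$ is the set of all complex eigenvalues of $A$. -/

import Mathlib

open Polynomial

noncomputable section

/-- Extended knot sequence
`0 = x_{-k} = ⋯ = x_0 < x_1 < ⋯ < x_n = ⋯ = x_{n+k} = 1`.
Only the values at the indices `-k, …, n + k` matter. -/
structure IsExtendedKnotSequence (n k : ℕ) (x : ℤ → ℝ) : Prop where
  left : ∀ j : ℤ, -(k : ℤ) ≤ j → j ≤ 0 → x j = 0
  strict : ∀ j : ℤ, 0 ≤ j → j < n → x j < x (j + 1)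
  right : ∀ j : ℤ, (n : ℤ) ≤ j → j ≤ n + k → x j = 1

/-- The Greville node `ξ_{j,k} = (x_{j+1} + ⋯ + x_{j+k}) / k`. -/
def grevilleNode (x : ℤ → ℝ) (k : ℕ) (j : ℤ) : ℝ :=
  (∑ l ∈ Finset.Icc 1 k, x (j + l)) / k

/-- The divided difference `[x_j, …, x_{j+m}] f` for nondecreasing knots, with the usual
confluent value `f^{(m)}(x_j) / m!` if all of `x_j, …, x_{j+m}` coincide. -/
def dividedDiff (x : ℤ → ℝ) (f : ℝ → ℝ) : ℕ → ℤ → ℝ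
  | 0, j => f (x j)
  | m + 1, j =>
    if x (j + (m + 1)) = x j then iteratedDeriv (m + 1) f (x j) / (m + 1).factorial
    else (dividedDiff x f m (j + 1) - dividedDiff x f m j) / (x (j + (m + 1)) - x j)

/-- The truncated power `t_+^k`. -/
def truncPow (k : ℕ) (t : ℝ) : ℝ := if 0 < t then t ^ k else 0

/-- The normalized B-spline
`N_{j,k}(y) = (x_{j+k+1} - x_j) [x_j, …, x_{j+k+1}] (· - y)_+^k` of degree `k`. -/
def bspline (x : ℤ → ℝ) (k : ℕ) (j : ℤ) (y : ℝ) : ℝ :=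
  (x (j + k + 1) - x j) * dividedDiff x (fun t => truncPow k (t - y)) (k + 1) j

/-- The B-spline normalized to have integral one,
`M_{j,k} = N_{j,k} / (ξ_{j,k+1} - ξ_{j-1,k+1})`. -/
def integralBspline (x : ℤ → ℝ) (k : ℕ) (j : ℤ) (y : ℝ) : ℝ :=
  bspline x k j y / (grevilleNode x (k + 1) j - grevilleNode x (k + 1) (j - 1))

/-- The collocation matrix with entries `∫ t in ξ_{i-1,k+1}..ξ_{i,k+1}, M_{j,k}(t)`, where
`i, j ∈ {-k, …, n-1}`; these indices are shifted by `k` to `0, …, n + k - 1`. -/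
def collocationMatrix (n k : ℕ) (x : ℤ → ℝ) : Matrix (Fin (n + k)) (Fin (n + k)) ℝ :=
  Matrix.of fun i j =>
    ∫ t in grevilleNode x (k + 1) ((i : ℤ) - k - 1)..grevilleNode x (k + 1) ((i : ℤ) - k),
      integralBspline x k ((j : ℤ) - k) t

/-- All minors (of all orders) are nonnegative. -/
def Matrix.IsTotallyNonneg {N : ℕ} (A : Matrix (Fin N) (Fin N) ℝ) : Prop :=
  ∀ (p : ℕ) (r c : Fin p ↪o Fin N), 0 ≤ (A.submatrix r c).det

/-- All minors (of all orders) are positive. -/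
def Matrix.IsStrictlyTotallyPos {N : ℕ} (A : Matrix (Fin N) (Fin N) ℝ) : Prop :=
  ∀ (p : ℕ) (r c : Fin p ↪o Fin N), 0 < (A.submatrix r c).det

/-- A square real matrix is oscillatory if all its minors are nonnegative and all minors of
some power with positive exponent are positive. -/
def Matrix.IsOscillatory {N : ℕ} (A : Matrix (Fin N) (Fin N) ℝ) : Prop :=
  A.IsTotallyNonneg ∧ ∃ m : ℕ, 0 < m ∧ (A ^ m).IsStrictlyTotallyPos

end

/-! Up to the factor `k + 1`, the entries of the matrix are integrals of divided differences of
truncated powers over the consecutive cells between Greville nodes. A minor is therefore an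
integral, over a product of ordered cells, of collocation determinants of B-splines
(`det_integral`). These determinants are nonnegative (`truncSpline_det_nonneg`): inserting a knot
writes every B-spline as a nonnegative combination of two adjacent finer ones, and once all nodes
are knots of multiplicity `k + 1` only the identity permutation can contribute.

A minor is strictly positive when each cell meets the support of the B-spline paired with it
(`det_setIntegral_truncSpline_pos`); this rests on local linear independence. The condition holds if
paired row and column indices differ by at most one. By Cauchy–Binet, a product of near-diagonal
minors moves any index set to any other, so every power with exponent at least `n + k` is strictly
totally positive.

The spectral part is the Gantmacher–Krein argument. Perron's theorem is applied to the compounds of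
such a power. After triangularization with diagonal of decreasing modulus, the product of the first
`p` diagonal entries is the Perron eigenvalue of the `p`-th compound (`exists_leading_prod_eq`).
Quotients of these products are positive, and a repeated eigenvalue would contradict simplicity in
some compound. Two consecutive powers give positivity for the matrix itself. -/

noncomputable section

/-! ### Hermite divided differences -/

/-- The divided difference `[x_j, …, x_{j+m}]` built from the Taylor coefficients
`F i a = f^{(i)}(a) / i!` at the knots. -/
def hermiteDiff (x : ℤ → ℝ) (F : ℕ → ℝ → ℝ) : ℕ → ℤ → ℝ
  | 0, j => F 0 (x j)
  | m + 1, j =>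
    if x (j + (m + 1)) = x j then F (m + 1) (x j)
    else (hermiteDiff x F m (j + 1) - hermiteDiff x F m j) / (x (j + (m + 1)) - x j)

theorem hermiteDiff_of_eq {x : ℤ → ℝ} {F : ℕ → ℝ → ℝ} {m : ℕ} {j : ℤ} (h : x (j + m) = x j) :
    hermiteDiff x F m j = F m (x j) := by
  cases m with
  | zero => rfl
  | succ m => push_cast at h; simp [hermiteDiff, h]

/-- In multiplied form the recursion needs no case distinction: if the end knots coincide, so do all
knots between them, and both sides vanish. -/
theorem hermiteDiff_rec {x : ℤ → ℝ} (hx : Monotone x) (F : ℕ → ℝ → ℝ) (m : ℕ) (j : ℤ) :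
    (x (j + (m + 1)) - x j) * hermiteDiff x F (m + 1) j =
      hermiteDiff x F m (j + 1) - hermiteDiff x F m j := by
  by_cases h : x (j + (m + 1)) = x j
  · have h1 : x (j + m) = x j :=
      le_antisymm ((hx (by omega)).trans h.le) (hx (by omega))
    have h2 : x (j + 1) = x j :=
      le_antisymm ((hx (by omega)).trans h.le) (hx (by omega))
    have h3 : x (j + 1 + m) = x (j + 1) := by rw [h2, ← h]; congr 1; ring
    rw [hermiteDiff_of_eq h1, hermiteDiff_of_eq h3, h2, h]; ring
  · have h' : x (j + (m + 1)) - x j ≠ 0 := sub_ne_zero.2 h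
    rw [hermiteDiff, if_neg h]; field_simp

theorem hermiteDiff_congr {x x' : ℤ → ℝ} (F : ℕ → ℝ → ℝ) (m : ℕ) (j j' : ℤ)
    (h : ∀ i : ℤ, 0 ≤ i → i ≤ m → x (j + i) = x' (j' + i)) :
    hermiteDiff x F m j = hermiteDiff x' F m j' := by
  induction m generalizing j j' with
  | zero => simpa [hermiteDiff] using congrArg (F 0) (h 0 le_rfl le_rfl)
  | succ m ih =>
    have h0 : x j = x' j' := by simpa using h 0 le_rfl (by positivity)
    have h1 := h (m + 1) (by positivity) (by push_cast; rfl)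
    rw [hermiteDiff, hermiteDiff, h0, h1, ih (j + 1) (j' + 1), ih j j']
    · intro i hi hi'; exact h i hi (by push_cast; omega)
    · intro i hi hi'
      have := h (1 + i) (by omega) (by push_cast; omega)
      rwa [← add_assoc, ← add_assoc] at this

/-- Insert the knot `z` at position `s`. -/
def insertKnot (x : ℤ → ℝ) (s : ℤ) (z : ℝ) (i : ℤ) : ℝ :=
  if i < s then x i else if i = s then z else x (i - 1)

/-! ### Knot insertion for divided differences -/

section insertion
variable {x : ℤ → ℝ} {s : ℤ} {z : ℝ}

theorem insertKnot_of_lt {i : ℤ} (h : i < s) : insertKnot x s z i = x i := by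
  simp [insertKnot, h]

theorem insertKnot_self : insertKnot x s z s = z := by simp [insertKnot]

theorem insertKnot_add_one {i : ℤ} (h : s ≤ i) : insertKnot x s z (i + 1) = x i := by
  have h1 : ¬ i + 1 < s := by omega
  have h2 : i + 1 ≠ s := by omega
  simp [insertKnot, h1, h2]

theorem insertKnot_monotone (hx : Monotone x) (h1 : x (s - 1) ≤ z) (h2 : z ≤ x s) :
    Monotone (insertKnot x s z) := by
  refine monotone_int_of_le_succ fun i => ?_
  rcases lt_trichotomy i s with h | rfl | h
  · rw [insertKnot_of_lt h]
    rcases (show i + 1 < s ∨ i + 1 = s by omega) with h' | h'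
    · rw [insertKnot_of_lt h']; exact hx (by omega)
    · rw [h', insertKnot_self]
      have : i = s - 1 := by omega
      rwa [this]
  · rwa [insertKnot_self, insertKnot_add_one le_rfl]
  · obtain ⟨i, rfl⟩ : ∃ i', i = i' + 1 := ⟨i - 1, by ring⟩
    rw [insertKnot_add_one (by omega), insertKnot_add_one (by omega)]
    exact hx (by omega)

theorem hermiteDiff_insertKnot_of_lt (F : ℕ → ℝ → ℝ) {m : ℕ} {j : ℤ} (h : j + m < s) :
    hermiteDiff (insertKnot x s z) F m j = hermiteDiff x F m j :=
  hermiteDiff_congr F m j j fun i _ hi => insertKnot_of_lt (by omega)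

theorem hermiteDiff_insertKnot_of_le (F : ℕ → ℝ → ℝ) {m : ℕ} {j : ℤ} (h : s ≤ j) :
    hermiteDiff (insertKnot x s z) F m (j + 1) = hermiteDiff x F m j :=
  hermiteDiff_congr F m (j + 1) j fun i hi _ => by
    rw [show j + 1 + i = j + i + 1 by ring]; exact insertKnot_add_one (by omega)

/-- This is the recursion with `z` and the last fine knot as the two omitted points: omitting `z`
leaves a coarse difference, omitting the last knot a fine one. The definition only omits end knots,
so this instance of symmetry needs an induction on the order. -/
theorem hermiteDiff_insertKnot (hx : Monotone x) (h1 : x (s - 1) ≤ z) (h2 : z ≤ x s)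
    (F : ℕ → ℝ → ℝ) (m : ℕ) (j : ℤ) (hj : j ≤ s) (hj' : s ≤ j + m + 1) :
    (insertKnot x s z (j + (m + 1)) - z) * hermiteDiff (insertKnot x s z) F (m + 1) j =
      hermiteDiff x F m j - hermiteDiff (insertKnot x s z) F m j := by
  have hx' := insertKnot_monotone hx h1 h2
  induction m generalizing j with
  | zero =>
    rcases (show j = s ∨ s = j + 1 by push_cast at hj'; omega) with rfl | rfl
    · have := hermiteDiff_rec hx' F 0 j
      rw [insertKnot_self] at this
      rw [this, hermiteDiff_insertKnot_of_le F le_rfl]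
    · simp [hermiteDiff, insertKnot]
  | succ m IH =>
    rcases hj.eq_or_lt with rfl | hj
    · have := hermiteDiff_rec hx' F (m + 1) j
      rw [insertKnot_self] at this
      rw [this, hermiteDiff_insertKnot_of_le F le_rfl]
    rcases hj'.eq_or_lt with hs | hj'
    · rw [← add_assoc, ← hs, insertKnot_self, sub_self, zero_mul,
        hermiteDiff_insertKnot_of_lt (m := m + 1) F (by omega), sub_self]
    push_cast at hj' ⊢
    have e1 := IH (j + 1) (by omega) (by omega)
    have e2 := IH j hj.le (by omega)
    have r1 := hermiteDiff_rec hx' F (m + 1) j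
    have r2 := hermiteDiff_rec hx' F m j
    have r3 := hermiteDiff_rec hx F m j
    have xa : insertKnot x s z j = x j := insertKnot_of_lt hj
    have xb : insertKnot x s z (j + (m + 1 + 1)) = x (j + (m + 1)) := by
      rw [show j + ((m : ℤ) + 1 + 1) = j + (m + 1) + 1 by ring]
      exact insertKnot_add_one (by omega)
    have xb' : insertKnot x s z (j + 1 + (m + 1)) = x (j + (m + 1)) := by
      rw [show j + 1 + ((m : ℤ) + 1) = j + (m + 1) + 1 by ring]
      exact insertKnot_add_one (by omega)
    push_cast at r1
    rw [xa, xb] at r1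
    rw [xb'] at e1
    rw [xa] at r2
    rw [xb]
    -- If the coarse end knots coincide, `z` is squeezed onto them and both differences of order `m
    -- + 1` are the same Taylor coefficient. Otherwise the width can be cancelled.
    by_cases hab : x (j + (m + 1)) = x j
    · have hz : z = x j := by
        have a1 : x j ≤ x (s - 1) := hx (by omega)
        have a2 : x s ≤ x (j + (m + 1)) := hx (by omega)
        linarith
      have e3 : insertKnot x s z (j + ((m + 1 : ℕ) : ℤ)) = insertKnot x s z j := by
        refine le_antisymm ?_ (hx' (by push_cast; omega))
        rw [xa, ← hab, ← xb]; exact hx' (by push_cast; omega)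
      rw [hermiteDiff_of_eq e3, hermiteDiff_of_eq (x := x) (by push_cast; exact hab), xa, hz, hab]
      ring
    · refine mul_left_cancel₀ (sub_ne_zero.2 hab) ?_
      linear_combination (x (j + (m + 1)) - z) * r1 - r3 + e1 - e2 + r2

end insertion

/-! ### Truncated powers and B-splines with arbitrary knots -/

/-- Taylor coefficients at `a` of the truncated power `(· - y)_+^k`. -/
def truncTaylor (k : ℕ) (y : ℝ) (m : ℕ) (a : ℝ) : ℝ :=
  if y < a then k.choose m * (a - y) ^ (k - m) else 0

/-- The divided difference `[x_j, …, x_{j+k+1}] (· - y)_+^k`. -/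
def truncSpline (x : ℤ → ℝ) (k : ℕ) (j : ℤ) (y : ℝ) : ℝ :=
  hermiteDiff x (truncTaylor k y) (k + 1) j

theorem truncTaylor_succ_zero (k : ℕ) (y a : ℝ) :
    truncTaylor (k + 1) y 0 a = (a - y) * truncTaylor k y 0 a := by
  unfold truncTaylor; split_ifs <;> simp; ring

/-- The Leibniz rule for multiplication by the affine factor `· - y`, which on coefficients is
Pascal's rule. -/
theorem truncTaylor_succ_succ (k m : ℕ) (y a : ℝ) :
    truncTaylor (k + 1) y (m + 1) a =
      (a - y) * truncTaylor k y (m + 1) a + truncTaylor k y m a := by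
  unfold truncTaylor; split_ifs
  · rw [Nat.choose_succ_succ, Nat.add_sub_add_right]
    rcases lt_or_ge m k with h | h
    · obtain ⟨d, rfl⟩ := Nat.exists_eq_add_of_lt h
      rw [show m + d + 1 - m = d + 1 by omega, show m + d + 1 - (m + 1) = d by omega]
      push_cast; ring
    · rw [Nat.choose_eq_zero_of_lt (show k < m + 1 by omega)]; simp
  · simp

variable {x : ℤ → ℝ}

/-- Leibniz rule for divided differences of `(· - y) * (· - y)_+^k`; only two terms survive because
the first factor is affine. -/
theorem hermiteDiff_truncTaylor_succ (hx : Monotone x) (k : ℕ) (y : ℝ) (m : ℕ) (j : ℤ) :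
    hermiteDiff x (truncTaylor (k + 1) y) (m + 1) j =
      (x (j + (m + 1)) - y) * hermiteDiff x (truncTaylor k y) (m + 1) j +
        hermiteDiff x (truncTaylor k y) m j := by
  induction m generalizing j with
  | zero =>
    by_cases h : x (j + 1) = x j
    · simp [hermiteDiff, h, truncTaylor_succ_succ]
    · have r0 := hermiteDiff_rec hx (truncTaylor (k + 1) y) 0 j
      have r1 := hermiteDiff_rec hx (truncTaylor k y) 0 j
      simp only [hermiteDiff, truncTaylor_succ_zero] at r0 r1
      simp only [Nat.cast_zero, zero_add] at r0 r1 ⊢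
      refine mul_left_cancel₀ (sub_ne_zero.2 h) ?_
      simp only [hermiteDiff, Nat.cast_zero, zero_add, truncTaylor_succ_zero] at r0 r1 ⊢
      linear_combination r0 - (x (j + 1) - y) * r1
  | succ m ih =>
    push_cast
    by_cases h : x (j + (m + 1 + 1)) = x j
    · have h2 : x (j + ((m + 1 : ℕ) : ℤ)) = x j :=
        le_antisymm ((hx (by push_cast; omega)).trans h.le) (hx (by push_cast; omega))
      rw [hermiteDiff_of_eq (by push_cast; exact h), hermiteDiff_of_eq (by push_cast; exact h),
        hermiteDiff_of_eq h2, truncTaylor_succ_succ, h]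
    · have r0 := hermiteDiff_rec hx (truncTaylor (k + 1) y) (m + 1) j
      have r1 := hermiteDiff_rec hx (truncTaylor k y) (m + 1) j
      have r2 := hermiteDiff_rec hx (truncTaylor k y) m j
      have e1 := ih (j + 1)
      have e2 := ih j
      rw [show j + 1 + ((m : ℤ) + 1) = j + (m + 1 + 1) by ring] at e1
      push_cast at r0 r1
      refine mul_left_cancel₀ (sub_ne_zero.2 h) ?_
      linear_combination r0 + e1 - e2 - (x (j + (m + 1 + 1)) - y) * r1 - r2

/-- The Taylor coefficient of order `k + 1` of a polynomial of degree `k` is zero. -/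
theorem truncSpline_of_eq {k : ℕ} {j : ℤ} (h : x (j + (k + 1)) = x j) (y : ℝ) :
    truncSpline x k j y = 0 := by
  rw [truncSpline, hermiteDiff_of_eq (by push_cast; exact h)]
  simp [truncTaylor]

theorem truncSpline_zero (hx : Monotone x) (j : ℤ) (y : ℝ) :
    (x (j + 1) - x j) * truncSpline x 0 j y =
      (if y < x (j + 1) then 1 else 0) - (if y < x j then 1 else 0) := by
  have := hermiteDiff_rec hx (truncTaylor 0 y) 0 j
  simpa [hermiteDiff, truncTaylor, truncSpline] using this

/-- The Cox–de Boor recursion. -/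
theorem truncSpline_succ (hx : Monotone x) (k : ℕ) (j : ℤ) (y : ℝ) :
    (x (j + (k + 2)) - x j) * truncSpline x (k + 1) j y =
      (x (j + (k + 2)) - y) * truncSpline x k (j + 1) y + (y - x j) * truncSpline x k j y := by
  have h1 := hermiteDiff_truncTaylor_succ hx k y (k + 1) j
  have h2 := hermiteDiff_rec hx (truncTaylor k y) (k + 1) j
  push_cast at h1 h2
  rw [show (k : ℤ) + 1 + 1 = k + 2 by ring] at h1 h2
  unfold truncSpline
  linear_combination (x (j + (k + 2)) - x j) * h1 + (x (j + (k + 2)) - y) * h2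

/-- Both claims are proved in one induction: the weights in the Cox–de Boor recursion are
nonnegative only on the supports of the B-splines they multiply. -/
theorem truncSpline_nonneg_and_support (hx : Monotone x) (k : ℕ) (j : ℤ) (y : ℝ) :
    0 ≤ truncSpline x k j y ∧
      (truncSpline x k j y ≠ 0 → x j ≤ y ∧ y < x (j + (k + 1))) := by
  induction k generalizing j with
  | zero =>
    have h := truncSpline_zero hx j y
    have hle : x j ≤ x (j + 1) := hx (by omega)
    simp only [Nat.cast_zero, zero_add]
    rcases hle.eq_or_lt with he | hlt
    · rw [truncSpline_of_eq (by simpa using he.symm)]; simp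
    · rw [mul_comm, ← eq_div_iff (sub_ne_zero.2 hlt.ne')] at h
      rw [h]
      have := sub_pos.2 hlt
      split_ifs with h1 h2 h2
      · simp
      · exact ⟨by simpa using this.le, fun _ => ⟨not_lt.1 h2, h1⟩⟩
      · linarith
      · simp
  | succ k ih =>
    push_cast
    rw [show (k : ℤ) + 1 + 1 = k + 2 by ring]
    have h := truncSpline_succ hx k j y
    have hle : x j ≤ x (j + (k + 2)) := hx (by omega)
    rcases hle.eq_or_lt with he | hlt
    · rw [truncSpline_of_eq (by push_cast; rw [he]; congr 1)]; simp
    · rw [mul_comm, ← eq_div_iff (sub_ne_zero.2 hlt.ne')] at h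
      obtain ⟨n1, s1⟩ := ih (j + 1)
      obtain ⟨n2, s2⟩ := ih j
      rw [show j + 1 + ((k : ℤ) + 1) = j + (k + 2) by ring] at s1
      have hj1 : x j ≤ x (j + 1) := hx (by omega)
      have hj2 : x (j + (k + 1)) ≤ x (j + (k + 2)) := hx (by omega)
      have p1 : 0 ≤ (x (j + (k + 2)) - y) * truncSpline x k (j + 1) y := by
        by_cases h0 : truncSpline x k (j + 1) y = 0
        · simp [h0]
        · exact mul_nonneg (sub_nonneg.2 (s1 h0).2.le) n1
      have p2 : 0 ≤ (y - x j) * truncSpline x k j y := by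
        by_cases h0 : truncSpline x k j y = 0
        · simp [h0]
        · exact mul_nonneg (sub_nonneg.2 (s2 h0).1) n2
      refine ⟨h ▸ div_nonneg (add_nonneg p1 p2) (sub_pos.2 hlt).le, fun hne => ?_⟩
      by_cases h1 : truncSpline x k (j + 1) y = 0
      · by_cases h2 : truncSpline x k j y = 0
        · simp [h, h1, h2] at hne
        · exact ⟨(s2 h2).1, (s2 h2).2.trans_le hj2⟩
      · exact ⟨hj1.trans (s1 h1).1, (s1 h1).2⟩

theorem truncSpline_nonneg (hx : Monotone x) (k : ℕ) (j : ℤ) (y : ℝ) :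
    0 ≤ truncSpline x k j y := (truncSpline_nonneg_and_support hx k j y).1

theorem truncSpline_support (hx : Monotone x) {k : ℕ} {j : ℤ} {y : ℝ}
    (h : truncSpline x k j y ≠ 0) : x j ≤ y ∧ y < x (j + (k + 1)) :=
  (truncSpline_nonneg_and_support hx k j y).2 h

/-- A point off the knots lies strictly on one side of `x (j + (k + 1))`, hence inside the support
of one of the two B-splines of lower degree. -/
theorem truncSpline_pos (hx : Monotone x) {k : ℕ} {j : ℤ} {y : ℝ} (hy : ∀ i, x i ≠ y)
    (h1 : x j < y) (h2 : y < x (j + (k + 1))) : 0 < truncSpline x k j y := by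
  induction k generalizing j with
  | zero =>
    simp only [Nat.cast_zero, zero_add] at h2
    have h := truncSpline_zero hx j y
    rw [if_pos h2, if_neg h1.le.not_gt] at h
    have : 0 < x (j + 1) - x j := by linarith
    exact pos_of_mul_pos_right (by rw [h]; norm_num) this.le
  | succ k ih =>
    push_cast at h2
    rw [show (k : ℤ) + 1 + 1 = k + 2 by ring] at h2
    have h := truncSpline_succ hx k j y
    have hb : 0 < x (j + (k + 2)) - y := sub_pos.2 h2
    have ha : 0 < y - x j := sub_pos.2 h1
    have n1 := mul_nonneg hb.le (truncSpline_nonneg hx k (j + 1) y)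
    have n2 := mul_nonneg ha.le (truncSpline_nonneg hx k j y)
    have hab : 0 < x (j + (k + 2)) - x j := by linarith
    refine pos_of_mul_pos_right (a := x (j + (k + 2)) - x j) ?_ hab.le
    rw [h]
    rcases (hy (j + (k + 1))).lt_or_gt with hk | hk
    · have : x (j + 1) < y := lt_of_le_of_lt (hx (by omega)) hk
      have := mul_pos hb (ih this (by rwa [show j + 1 + ((k : ℤ) + 1) = j + (k + 2) by ring]))
      linarith
    · have := mul_pos ha (ih h1 hk)
      linarith

/-- Knot insertion expresses each coarse B-spline as a nonnegative combination of two adjacent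
fine ones. -/
theorem exists_truncSpline_eq_insertKnot (hx : Monotone x) {s : ℤ} {z : ℝ}
    (h1 : x (s - 1) ≤ z) (h2 : z ≤ x s) (k : ℕ) (j : ℤ) :
    ∃ a b : ℝ, 0 ≤ a ∧ 0 ≤ b ∧ ∀ y, truncSpline x k j y =
      a * truncSpline (insertKnot x s z) k j y +
        b * truncSpline (insertKnot x s z) k (j + 1) y := by
  rcases le_or_gt s j with hs | hs
  · exact ⟨0, 1, le_rfl, zero_le_one, fun y => by
      simp [truncSpline, hermiteDiff_insertKnot_of_le _ hs]⟩
  rcases lt_or_ge (j + (k + 1)) s with hs' | hs'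
  · exact ⟨1, 0, zero_le_one, le_rfl, fun y => by
      simp [truncSpline, hermiteDiff_insertKnot_of_lt _ (by exact hs')]⟩
  have a1 : x j ≤ x (s - 1) := hx (by omega)
  have a2 : x s ≤ x (j + (k + 1)) := hx hs'
  rcases (hx (by omega) : x j ≤ x (j + (k + 1))).eq_or_lt with he | hlt
  · exact ⟨0, 0, le_rfl, le_rfl, fun y => by simp [truncSpline_of_eq he.symm]⟩
  have hd := sub_pos.2 hlt
  -- Boehm's weights: subtract `hermiteDiff_insertKnot` at `j` from its instance at `j + 1` and use
  -- the recursion for the coarse and the fine knots.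
  refine ⟨(z - x j) / (x (j + (k + 1)) - x j), (x (j + (k + 1)) - z) / (x (j + (k + 1)) - x j),
    div_nonneg (by linarith) hd.le, div_nonneg (by linarith) hd.le, fun y => ?_⟩
  have hx' := insertKnot_monotone hx h1 h2
  have i1 := hermiteDiff_insertKnot hx h1 h2 (truncTaylor k y) k j hs.le (by omega)
  have i2 := hermiteDiff_insertKnot hx h1 h2 (truncTaylor k y) k (j + 1) (by omega) (by omega)
  have r' := hermiteDiff_rec hx' (truncTaylor k y) k j
  have r := hermiteDiff_rec hx (truncTaylor k y) k j
  rw [show j + 1 + ((k : ℤ) + 1) = j + (k + 1) + 1 by ring, insertKnot_add_one hs'] at i2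
  rw [insertKnot_of_lt hs] at r'
  unfold truncSpline
  field_simp
  linear_combination r - i2 - r' + i1

/-! ### Total positivity of B-spline collocation matrices -/

/-- Expanding by multilinearity replaces each index `c j` by itself or its successor. The new
indices are still weakly increasing, so either they increase strictly or two columns agree and the
determinant vanishes. -/
theorem det_nonneg_of_adjacent_combination {p : ℕ} {f g : ℤ → Fin p → ℝ} {a b : ℤ → ℝ}
    (ha : ∀ j, 0 ≤ a j) (hb : ∀ j, 0 ≤ b j) (hf : ∀ j, f j = a j • g j + b j • g (j + 1))
    (hg : ∀ c : Fin p → ℤ, StrictMono c → 0 ≤ (Matrix.of fun i j => g (c j) i).det)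
    {c : Fin p → ℤ} (hc : StrictMono c) : 0 ≤ (Matrix.of fun i j => f (c j) i).det := by
  have key : (Matrix.of fun i j => f (c j) i).det =
      ∑ s : Finset (Fin p), (∏ j, if j ∈ s then a (c j) else b (c j)) *
        (Matrix.of fun i j => g (c j + if j ∈ s then 0 else 1) i).det := by
    rw [← Matrix.det_transpose]
    change Matrix.detRowAlternating.toMultilinearMap (fun j => f (c j)) = _
    rw [show (fun j => f (c j)) = (fun j => a (c j) • g (c j)) + fun j => b (c j) • g (c j + 1)
      from funext fun j => hf _, MultilinearMap.map_add_univ]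
    refine Finset.sum_congr rfl fun s _ => ?_
    rw [← Matrix.det_transpose, ← smul_eq_mul]
    refine Eq.trans ?_ (MultilinearMap.map_smul_univ Matrix.detRowAlternating.toMultilinearMap
      (fun j => if j ∈ s then a (c j) else b (c j))
      (fun j => g (c j + if j ∈ s then 0 else 1)))
    congr 1
    funext j
    by_cases h : j ∈ s <;> simp [h]
  rw [key]
  refine Finset.sum_nonneg fun s _ => mul_nonneg
    (Finset.prod_nonneg fun j _ => by split_ifs <;> simp [ha, hb]) ?_
  by_cases hs : StrictMono fun j => c j + if j ∈ s then 0 else 1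
  · exact hg _ hs
  · simp only [StrictMono, not_forall] at hs
    obtain ⟨i, j, hij, hle⟩ := hs
    have hlt := hc hij
    have he : (c i + if i ∈ s then 0 else 1) = c j + if j ∈ s then 0 else 1 := by
      revert hle; split_ifs <;> omega
    refine (Matrix.det_zero_of_column_eq hij.ne fun r => ?_).ge
    simp only [Matrix.of_apply, he]

theorem insertKnot_embed {s : ℤ} {z : ℝ} (i : ℤ) :
    insertKnot x s z (if i < s then i else i + 1) = x i := by
  split_ifs with h
  · exact insertKnot_of_lt h
  · exact insertKnot_add_one (not_lt.1 h)

/-- The value `z` occurs at least `r + 1` times among the knots. -/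
def KnotMultiplicity (x : ℤ → ℝ) (z : ℝ) (r : ℕ) : Prop :=
  ∃ a b : ℤ, a + r ≤ b ∧ x a = z ∧ x b = z

theorem KnotMultiplicity.insertKnot {z : ℝ} {r : ℕ} (h : KnotMultiplicity x z r) (s : ℤ) (w : ℝ) :
    KnotMultiplicity (insertKnot x s w) z r := by
  obtain ⟨a, b, hab, ha, hb⟩ := h
  refine ⟨_, _, ?_, (insertKnot_embed a).trans ha, (insertKnot_embed b).trans hb⟩
  split_ifs <;> omega

/-- A permutation with nonzero product must be increasing, hence the identity. -/
theorem det_nonneg_of_column_support {p : ℕ} {M : Matrix (Fin p) (Fin p) ℝ}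
    (h0 : ∀ i j, 0 ≤ M i j)
    (h : ∀ i i' j j', j < j' → M i j ≠ 0 → M i' j' ≠ 0 → i ≤ i') : 0 ≤ M.det := by
  rw [Matrix.det_apply']
  refine Finset.sum_nonneg fun σ _ => ?_
  by_cases hz : ∏ i, M (σ i) i = 0
  · simp [hz]
  · have hne : ∀ i, M (σ i) i ≠ 0 := fun i => (Finset.prod_ne_zero_iff.1 hz) i (Finset.mem_univ i)
    have hσ : StrictMono σ := fun i j hij =>
      lt_of_le_of_ne (h _ _ _ _ hij (hne i) (hne j)) (σ.injective.ne hij.ne)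
    have : σ = 1 := by
      have := Subsingleton.elim (hσ.orderIsoOfSurjective σ σ.surjective) (OrderIso.refl (Fin p))
      exact Equiv.ext fun i => congrArg (fun e : Fin p ≃o Fin p => e i) this
    subst this
    simpa using Finset.prod_nonneg fun i _ => h0 i i

theorem exists_insert_position (hx : Monotone x) {z : ℝ} (hl : ∃ l, x l ≤ z) (hr : ∃ r, z < x r) :
    ∃ s, x (s - 1) ≤ z ∧ z < x s := by
  obtain ⟨r, hr⟩ := hr
  obtain ⟨s, hs, hmax⟩ := Int.exists_greatest_of_bdd (P := fun i => x i ≤ z)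
    ⟨r, fun i hi => not_lt.1 fun h => absurd (hx h.le) (by linarith)⟩ hl
  exact ⟨s + 1, by simpa using hs, not_le.1 fun h => by have := hmax _ h; omega⟩

theorem truncSpline_det_nonneg (hx : Monotone x) (k : ℕ) {p : ℕ} {y : Fin p → ℝ}
    (hy : StrictMono y) (hl : ∀ i, ∃ l, x l ≤ y i) (hr : ∀ i, ∃ r, y i < x r)
    {c : Fin p → ℤ} (hc : StrictMono c) :
    0 ≤ (Matrix.of fun i j => truncSpline x k (c j) (y i)).det := by
  -- `T` holds the nodes that may still lack multiplicity `k + 1`; the knots are generalized because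
  -- each induction step refines them.
  suffices H : ∀ T : Finset (Fin p), ∀ x : ℤ → ℝ, Monotone x → (∀ i, ∃ l, x l ≤ y i) →
      (∀ i, ∃ r, y i < x r) → (∀ i ∉ T, KnotMultiplicity x (y i) k) →
      ∀ c : Fin p → ℤ, StrictMono c →
        0 ≤ (Matrix.of fun i j => truncSpline x k (c j) (y i)).det from
    H Finset.univ x hx hl hr (by simp) c hc
  have step : ∀ x : ℤ → ℝ, Monotone x → ∀ (s : ℤ) (z : ℝ), x (s - 1) ≤ z → z ≤ x s →
      (∀ c : Fin p → ℤ, StrictMono c →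
        0 ≤ (Matrix.of fun i j => truncSpline (insertKnot x s z) k (c j) (y i)).det) →
      ∀ c : Fin p → ℤ, StrictMono c →
        0 ≤ (Matrix.of fun i j => truncSpline x k (c j) (y i)).det := by
    intro x hx s z h1 h2 h c hc
    choose a b ha hb hab using exists_truncSpline_eq_insertKnot hx h1 h2 k
    exact det_nonneg_of_adjacent_combination (f := fun j i => truncSpline x k j (y i))
      (g := fun j i => truncSpline (insertKnot x s z) k j (y i)) ha hb
      (fun j => funext fun i => by simp [hab]) h hc
  intro T
  induction T using Finset.induction_on with
  | empty =>
    intro x hx _ _ hm c hc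
    refine det_nonneg_of_column_support (fun i j => truncSpline_nonneg hx _ _ _) ?_
    intro i i' j j' hj h1 h2
    by_contra! hlt
    obtain ⟨a, b, hab, ha, hb⟩ := hm i (by simp)
    have s1 := truncSpline_support hx h1
    have s2 := truncSpline_support hx h2
    have hy' := hy hlt
    have hcj := hc hj
    -- The support of `c j'` begins before all copies of `y i`, and that of `c j` ends after all of
    -- them. As there are at least `k + 1` copies, `c j ≥ a > c j'`, against the order of the
    -- columns.
    have ha' : c j' < a := by
      by_contra! h; have := hx h; linarith
    have hb' : b < c j + (k + 1) := by
      by_contra! h; have := hx h; linarith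
    omega
  | insert i T _ ih =>
    have lift : ∀ x : ℤ → ℝ, ∀ s z, (∀ i, ∃ l, x l ≤ y i) → (∀ i, ∃ r, y i < x r) →
        (∀ i, ∃ l, insertKnot x s z l ≤ y i) ∧ (∀ i, ∃ r, y i < insertKnot x s z r) := by
      intro x s z hl hr
      refine ⟨fun i => ?_, fun i => ?_⟩
      · obtain ⟨l, h⟩ := hl i; exact ⟨_, (insertKnot_embed l).trans_le h⟩
      · obtain ⟨r, h⟩ := hr i; exact ⟨_, h.trans_eq (insertKnot_embed r).symm⟩
    -- `d` counts the copies of `y i` still to be inserted.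
    have main : ∀ d r : ℕ, r + d = k → ∀ x : ℤ → ℝ, Monotone x → (∀ i, ∃ l, x l ≤ y i) →
        (∀ i, ∃ r, y i < x r) → (∀ i' ∉ insert i T, KnotMultiplicity x (y i') k) →
        KnotMultiplicity x (y i) r → ∀ c : Fin p → ℤ, StrictMono c →
        0 ≤ (Matrix.of fun i j => truncSpline x k (c j) (y i)).det := by
      intro d
      induction d with
      | zero =>
        intro r hrk x hx hl hr hm hi
        obtain rfl : r = k := by omega
        refine ih x hx hl hr fun i' hi' => ?_
        by_cases h : i' = i
        · rwa [h]
        · exact hm i' (by simp [h, hi'])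
      | succ d ihd =>
        intro r hrk x hx hl hr hm hi
        obtain ⟨a, b, hab, ha, hb⟩ := hi
        have h1 : x (a - 1) ≤ y i := ha ▸ hx (by omega)
        refine step x hx a (y i) h1 ha.ge (ihd (r + 1) (by omega) _
          (insertKnot_monotone hx h1 ha.ge) (lift _ _ _ hl hr).1 (lift _ _ _ hl hr).2
          (fun i' hi' => (hm i' hi').insertKnot _ _)
          ⟨a, b + 1, by push_cast; omega, insertKnot_self, ?_⟩)
        rw [insertKnot_add_one (by omega), hb]
    intro x hx hl hr hm
    obtain ⟨s, h1, h2⟩ := exists_insert_position hx (hl i) (hr i)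
    exact step x hx s (y i) h1 h2.le (main k 0 (by omega) _ (insertKnot_monotone hx h1 h2.le)
      (lift _ _ _ hl hr).1 (lift _ _ _ hl hr).2 (fun i' hi' => (hm i' hi').insertKnot _ _)
      ⟨s, s, by simp, insertKnot_self, insertKnot_self⟩)

/-! ### Local linear independence -/

theorem hasDerivAt_truncTaylor (k m : ℕ) {a y : ℝ} (h : a ≠ y) :
    HasDerivAt (fun y => truncTaylor (k + 1) y m a) (-(k + 1) * truncTaylor k y m a) y := by
  unfold truncTaylor
  rcases h.lt_or_gt with h | h
  · rw [if_neg h.le.not_gt, mul_zero]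
    refine (hasDerivAt_const y (0 : ℝ)).congr_of_eventuallyEq ?_
    filter_upwards [lt_mem_nhds h] with t ht
    rw [if_neg ht.le.not_gt]
  · rw [if_pos h]
    have h1 : HasDerivAt (fun t : ℝ => ((k + 1).choose m : ℝ) * (a - t) ^ (k + 1 - m))
        (((k + 1).choose m : ℝ) * (((k + 1 - m : ℕ) : ℝ) * (a - y) ^ (k + 1 - m - 1) * (-1))) y :=
      (((hasDerivAt_id y).const_sub a).pow _).const_mul _
    refine (h1.congr_deriv ?_).congr_of_eventuallyEq ?_
    · have h2 : ((k + 1).choose m : ℝ) * ((k + 1 - m : ℕ) : ℝ) = (k + 1) * (k.choose m : ℝ) := by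
        exact_mod_cast Nat.choose_mul_succ_eq k m |>.symm.trans (mul_comm _ _)
      rw [show k + 1 - m - 1 = k - m by omega]
      linear_combination (-(a - y) ^ (k - m)) * h2
    · filter_upwards [gt_mem_nhds h] with t ht
      rw [if_pos ht]

/-- Differentiation in `y` commutes with divided differences in the knots and lowers the degree of
the truncated power. -/
theorem hasDerivAt_hermiteDiff (k m : ℕ) (j : ℤ) {y : ℝ} (h : ∀ i, x i ≠ y) :
    HasDerivAt (fun y => hermiteDiff x (truncTaylor (k + 1) y) m j)
      (-(k + 1) * hermiteDiff x (truncTaylor k y) m j) y := by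
  induction m generalizing j with
  | zero => exact hasDerivAt_truncTaylor k 0 (h j)
  | succ m ih =>
    simp only [hermiteDiff]
    split_ifs
    · exact hasDerivAt_truncTaylor k (m + 1) (h j)
    · exact (((ih (j + 1)).sub (ih j)).div_const _).congr_deriv (by ring)

theorem hasDerivAt_truncSpline (hx : Monotone x) (k : ℕ) {j : ℤ} {y : ℝ} (h : ∀ i, x i ≠ y)
    (hj : x j < x (j + (k + 2))) :
    HasDerivAt (truncSpline x (k + 1) j) (-(k + 1) / (x (j + (k + 2)) - x j) *
      (truncSpline x k (j + 1) y - truncSpline x k j y)) y := by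
  refine (hasDerivAt_hermiteDiff k (k + 2) j h).congr_deriv ?_
  have := hermiteDiff_rec hx (truncTaylor k y) (k + 1) j
  push_cast at this
  rw [show (k : ℤ) + 1 + 1 = k + 2 by ring] at this
  have hd : x (j + (k + 2)) - x j ≠ 0 := (sub_pos.2 hj).ne'
  unfold truncSpline
  field_simp
  linear_combination -this

theorem continuousAt_truncSpline (k : ℕ) (j : ℤ) {y : ℝ} (h : ∀ i, x i ≠ y) :
    ContinuousAt (truncSpline x (k + 1) j) y :=
  (hasDerivAt_hermiteDiff k (k + 2) j h).continuousAt

theorem ne_of_mem_knot_interval (hx : Monotone x) {m : ℤ} {y : ℝ} (h1 : x m < y)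
    (h2 : y < x (m + 1)) (i : ℤ) : x i ≠ y := by
  rcases le_or_gt i m with h | h
  · exact ((hx h).trans_lt h1).ne
  · exact (h2.trans_le (hx h)).ne'

/-- Induction on the degree by differentiating the relation. Summation by parts gives a relation of
lower degree among differences of the rescaled coefficients, so these are all equal; a positive sum
then forces the common value to be zero. -/
theorem truncSpline_linearIndependent_range (hx : Monotone x) (k : ℕ) {b : ℤ} {u v : ℝ}
    (huv : u < v) (hu : x (b + k) ≤ u) (hv : v ≤ x (b + k + 1)) {c : ℕ → ℝ}
    (hc : ∀ y ∈ Set.Ioo u v, ∑ i ∈ Finset.range (k + 1), c i * truncSpline x k (b + i) y = 0) :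
    ∀ i < k + 1, c i = 0 := by
  have hne : ∀ y ∈ Set.Ioo u v, ∀ i, x i ≠ y := fun y hy =>
    ne_of_mem_knot_interval hx (hu.trans_lt hy.1) (hy.2.trans_le hv)
  have hpos : ∀ (k' : ℕ) (i : ℤ), i ≤ b + k → b + k < i + (k' + 1) → ∀ y ∈ Set.Ioo u v,
      0 < truncSpline x k' i y := fun k' i h1 h2 y hy =>
    truncSpline_pos hx (hne y hy) ((hx h1).trans_lt (hu.trans_lt hy.1))
      ((hy.2.trans_le hv).trans_le (hx (by omega)))
  induction k generalizing b c with
  | zero =>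
    intro i hi
    obtain rfl : i = 0 := by omega
    have hy : (u + v) / 2 ∈ Set.Ioo u v := ⟨by linarith, by linarith⟩
    have := hc _ hy
    simp only [zero_add, Finset.sum_range_one] at this
    exact (mul_eq_zero.1 this).resolve_right (hpos 0 _ (by simp) (by simp) _ hy).ne'
  | succ k ih =>
    push_cast at hu hv hpos
    have hlt : ∀ i : ℕ, i < k + 2 → 0 < x (b + i + (k + 2)) - x (b + i) := fun i hi => by
      have h1 : x (b + i) ≤ u := le_trans (hx (by omega)) hu
      have h2 : v ≤ x (b + i + (k + 2)) := le_trans hv (hx (by omega))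
      linarith
    set d : ℕ → ℝ := fun i => c i / (x (b + i + (k + 2)) - x (b + i)) with hd
    have hder : ∀ y ∈ Set.Ioo u v,
        ∑ i ∈ Finset.range (k + 1), (d (i + 1) - d i) * truncSpline x k (b + 1 + i) y = 0 := by
      intro y hy
      have h1 : HasDerivAt (fun y => ∑ i ∈ Finset.range (k + 2), c i *
          truncSpline x (k + 1) (b + i) y) (∑ i ∈ Finset.range (k + 2), c i *
            (-(k + 1) / (x (b + i + (k + 2)) - x (b + i)) *
              (truncSpline x k (b + i + 1) y - truncSpline x k (b + i) y))) y :=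
        HasDerivAt.fun_sum fun i hi => (hasDerivAt_truncSpline hx k (hne y hy)
          (sub_pos.1 (hlt i (Finset.mem_range.1 hi)))).const_mul _
      have h2 := h1.unique ((hasDerivAt_const y (0 : ℝ)).congr_of_eventuallyEq
        (Filter.eventually_of_mem (Ioo_mem_nhds hy.1 hy.2) hc))
      -- The two boundary terms of the summation by parts have supports ending before, respectively
      -- starting after, the interval.
      have e0 : truncSpline x k b y = 0 := by
        by_contra h
        have := (truncSpline_support hx h).2
        have h3 : x (b + (k + 1)) < y := hu.trans_lt hy.1
        linarith
      have e1 : truncSpline x k (b + (k + 2 : ℕ)) y = 0 := by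
        by_contra h
        have := (truncSpline_support hx h).1
        have h3 : y < x (b + (k + 2 : ℕ)) := (hy.2.trans_le hv).trans_le (hx (by push_cast; omega))
        linarith
      have h3 : (∑ i ∈ Finset.range (k + 2), d i *
          (truncSpline x k (b + (i + 1 : ℕ)) y - truncSpline x k (b + i) y)) = 0 := by
        have hk : (-(k + 1) : ℝ) ≠ 0 := by
          have : (0 : ℝ) < k + 1 := by positivity
          linarith
        refine (mul_eq_zero.1 ?_).resolve_left hk
        rw [← h2, Finset.mul_sum]
        refine Finset.sum_congr rfl fun i _ => ?_
        rw [hd]; push_cast; ring_nf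
      have h4 : (∑ i ∈ Finset.range (k + 2), d i *
          (truncSpline x k (b + (i + 1 : ℕ)) y - truncSpline x k (b + i) y)) =
          -∑ i ∈ Finset.range (k + 1), (d (i + 1) - d i) *
            truncSpline x k (b + (i + 1 : ℕ)) y := by
        simp only [mul_sub, sub_mul, Finset.sum_sub_distrib]
        rw [Finset.sum_range_succ, Finset.sum_range_succ' (fun i => d i * truncSpline x k (b + i) y)]
        rw [show k + 1 + 1 = k + 2 by ring, e1]
        simp only [Nat.cast_zero, add_zero, e0]
        ring
      rw [h4, neg_eq_zero] at h3
      rw [← h3]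
      refine Finset.sum_congr rfl fun i _ => ?_
      rw [show b + 1 + (i : ℤ) = b + (i + 1 : ℕ) by push_cast; ring]
    have hdc := ih (b := b + 1) (by convert hu using 2; ring) (by convert hv using 2; ring) hder
      (fun k' i h1 h2 => hpos k' i (by omega) (by omega))
    have hd0 : ∀ i < k + 2, d i = d 0 := by
      intro i
      induction i with
      | zero => simp
      | succ i ihi => intro hi; rw [← ihi (by omega)]; exact sub_eq_zero.1 (hdc i (by omega))
    have hcd : ∀ i < k + 2, c i = d 0 * (x (b + i + (k + 2)) - x (b + i)) := fun i hi => by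
      rw [← hd0 i hi, hd]; have := (hlt i hi).ne'; field_simp
    have hy : (u + v) / 2 ∈ Set.Ioo u v := ⟨by linarith, by linarith⟩
    have h0 := hc _ hy
    have h1 : ∑ i ∈ Finset.range (k + 2), c i * truncSpline x (k + 1) (b + i) ((u + v) / 2) =
        d 0 * ∑ i ∈ Finset.range (k + 2), (x (b + i + (k + 2)) - x (b + i)) *
          truncSpline x (k + 1) (b + i) ((u + v) / 2) := by
      rw [Finset.mul_sum]
      refine Finset.sum_congr rfl fun i hi => ?_
      rw [hcd i (Finset.mem_range.1 hi)]; ring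
    rw [show k + 1 + 1 = k + 2 by ring, h1] at h0
    have h2 : 0 < ∑ i ∈ Finset.range (k + 2), (x (b + i + (k + 2)) - x (b + i)) *
          truncSpline x (k + 1) (b + i) ((u + v) / 2) :=
      Finset.sum_pos (fun i hi => mul_pos (hlt i (Finset.mem_range.1 hi))
        (hpos _ _ (by have := Finset.mem_range.1 hi; omega) (by push_cast; omega) _ hy)) (by simp)
    intro i hi
    rw [hcd i hi, (mul_eq_zero.1 h0).resolve_right h2.ne', zero_mul]

/-- B-splines which do not vanish on a subinterval between two adjacent knots are linearly
independent there. -/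
theorem truncSpline_locally_linearIndependent (hx : Monotone x) (k : ℕ) {m : ℤ} {u v : ℝ}
    (huv : u < v) (hu : x m ≤ u) (hv : v ≤ x (m + 1)) {ι : Type*} [Fintype ι] {c : ι → ℤ}
    (hc : Function.Injective c) {w : ι → ℝ}
    (h : ∀ y ∈ Set.Ioo u v, ∑ i, w i * truncSpline x k (c i) y = 0) {i : ι}
    (h1 : c i ≤ m) (h2 : m ≤ c i + k) : w i = 0 := by
  classical
  -- The B-splines of degree `k` alive between `x m` and `x (m + 1)` are those with index from `m -
  -- k` to `m`; all others drop out of the relation.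
  have key := truncSpline_linearIndependent_range hx k (b := m - k) huv
    (by simpa using hu) (by simpa using hv)
    (c := fun l => ∑ i, if c i = m - k + l then w i else 0) ?_
  · obtain ⟨l, hl⟩ := Int.eq_ofNat_of_zero_le (show 0 ≤ c i - (m - k) by omega)
    have := key l (by omega)
    rw [Finset.sum_eq_single i] at this
    · rwa [if_pos (by omega)] at this
    · intro i' _ hi'
      rw [if_neg]
      intro he; exact hi' (hc (by omega))
    · simp
  · intro y hy
    refine Eq.trans ?_ (h y hy)
    simp only [Finset.sum_mul]
    rw [Finset.sum_comm]
    refine Finset.sum_congr rfl fun i _ => ?_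
    by_cases hi : ∃ l ∈ Finset.range (k + 1), c i = m - k + (l : ℕ)
    · obtain ⟨l, hl, he⟩ := hi
      rw [Finset.sum_eq_single_of_mem l hl, if_pos he, he]
      intro l' _ hne
      rw [if_neg (by omega), zero_mul]
    · have hz : truncSpline x k (c i) y = 0 := by
        by_contra hne
        obtain ⟨s1, s2⟩ := truncSpline_support hx hne
        have a1 : c i ≤ m := by
          by_contra! hh; have := hx (show m + 1 ≤ c i by omega); linarith [hy.2]
        have a2 : m < c i + (k + 1) := by
          by_contra! hh; have := hx hh; linarith [hy.1]
        exact hi ⟨(c i - (m - k)).toNat, by simp; omega, by omega⟩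
      rw [hz, mul_zero]
      refine Finset.sum_eq_zero fun l hl => ?_
      rw [if_neg fun he => hi ⟨l, hl, he⟩, zero_mul]

/-! ### Minors of matrices of integrals -/

-- Each Leibniz term is a product of one-variable integrals, hence an integral for the product
-- measure. Every row carries its own measure, so no symmetrization is needed.
open MeasureTheory in
theorem det_integral {p : ℕ} (μ : Fin p → Measure ℝ) [∀ i, SigmaFinite (μ i)] {f : Fin p → ℝ → ℝ}
    (hf : ∀ i j, Integrable (f j) (μ i)) :
    (Matrix.of fun i j => ∫ s, f j s ∂μ i).det =
      ∫ t : Fin p → ℝ, (Matrix.of fun i j => f j (t i)).det ∂Measure.pi μ := by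
  simp only [← Matrix.det_transpose (Matrix.of fun i j => ∫ s, f j s ∂μ i),
    ← Matrix.det_transpose (Matrix.of fun i j => f j (_ : ℝ)), Matrix.det_apply',
    Matrix.transpose_apply, Matrix.of_apply]
  rw [integral_finsetSum]
  · refine Finset.sum_congr rfl fun σ _ => ?_
    rw [integral_const_mul, ← integral_fintype_prod_eq_prod]
  · intro σ _
    exact (Integrable.fintype_prod_dep (f := fun i => f (σ i)) fun i => hf i (σ i)).const_mul _

open MeasureTheory in
theorem det_integral_nonneg {p : ℕ} (μ : Fin p → Measure ℝ) [∀ i, SigmaFinite (μ i)]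
    {S : Fin p → Set ℝ} (hS : ∀ i, ∀ᵐ t ∂μ i, t ∈ S i)
    (hord : ∀ i i', i < i' → ∀ s ∈ S i, ∀ t ∈ S i', s < t) {f : Fin p → ℝ → ℝ}
    (hf : ∀ i j, Integrable (f j) (μ i))
    (hdet : ∀ t : Fin p → ℝ, (∀ i, t i ∈ S i) → StrictMono t →
      0 ≤ (Matrix.of fun i j => f j (t i)).det) :
    0 ≤ (Matrix.of fun i j => ∫ s, f j s ∂μ i).det := by
  rw [det_integral μ hf]
  refine integral_nonneg_of_ae ?_
  have h : ∀ᵐ t ∂Measure.pi μ, ∀ i, t i ∈ S i :=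
    Filter.eventually_all.2 fun i => Measure.tendsto_eval_ae_ae.eventually (hS i)
  filter_upwards [h] with t ht
  exact hdet t ht fun i i' hi => hord i i' hi _ (ht i) _ (ht i')

open MeasureTheory in
theorem setIntegral_pos_of_continuousAt {u v : ℝ} {g : ℝ → ℝ} (hg : IntegrableOn g (Set.Ioo u v))
    (h0 : ∀ y ∈ Set.Ioo u v, 0 ≤ g y) {y : ℝ} (hy : y ∈ Set.Ioo u v) (hc : ContinuousAt g y)
    (hpos : 0 < g y) : 0 < ∫ t in Set.Ioo u v, g t := by
  rw [setIntegral_pos_iff_support_of_nonneg_ae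
    (ae_restrict_of_forall_mem measurableSet_Ioo h0) hg]
  refine Measure.measure_pos_of_mem_nhds volume (x := y) ?_
  filter_upwards [hc.eventually (lt_mem_nhds hpos), Ioo_mem_nhds hy.1 hy.2] with t h1 h2
  exact ⟨h1.ne', h2⟩

open MeasureTheory in
theorem locallyIntegrable_truncTaylor (k m : ℕ) (a : ℝ) :
    LocallyIntegrable fun y => truncTaylor k y m a := by
  have h : Continuous fun y : ℝ => (k.choose m : ℝ) * (a - y) ^ (k - m) := by fun_prop
  exact h.locallyIntegrable.indicator (measurableSet_Iio (a := a))

open MeasureTheory in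
theorem locallyIntegrable_hermiteDiff (k m : ℕ) (j : ℤ) :
    LocallyIntegrable fun y => hermiteDiff x (truncTaylor k y) m j := by
  induction m generalizing j with
  | zero => exact locallyIntegrable_truncTaylor k 0 _
  | succ m ih =>
    simp only [hermiteDiff]
    split_ifs
    · exact locallyIntegrable_truncTaylor k (m + 1) _
    · exact (((ih (j + 1)).sub (ih j)).smul (x (j + (m + 1)) - x j)⁻¹).congr
        (Filter.Eventually.of_forall fun y => by simp [div_eq_inv_mul])

open MeasureTheory in
theorem integrableOn_truncSpline (k : ℕ) (j : ℤ) (u v : ℝ) :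
    IntegrableOn (truncSpline x k j) (Set.Ioo u v) :=
  ((locallyIntegrable_hermiteDiff k (k + 1) j).integrableOn_isCompact
    isCompact_Icc).mono_set Set.Ioo_subset_Icc_self

-- Stated for general measures so that single rows may also be point evaluations, as the positivity
-- proof requires.
open MeasureTheory in
theorem det_integral_truncSpline_nonneg (hx : Monotone x) (k : ℕ) {p : ℕ}
    (μ : Fin p → Measure ℝ) [∀ i, SigmaFinite (μ i)]
    {S : Fin p → Set ℝ} (hS : ∀ i, ∀ᵐ t ∂μ i, t ∈ S i)
    (hord : ∀ i i', i < i' → ∀ s ∈ S i, ∀ t ∈ S i', s < t)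
    (hl : ∀ i, ∀ t ∈ S i, ∃ l, x l ≤ t) (hr : ∀ i, ∀ t ∈ S i, ∃ r, t < x r)
    (hint : ∀ i j, Integrable (truncSpline x k j) (μ i)) {c : Fin p → ℤ} (hc : StrictMono c) :
    0 ≤ (Matrix.of fun i j => ∫ s, truncSpline x k (c j) s ∂μ i).det :=
  det_integral_nonneg μ hS hord (fun i j => hint i (c j)) fun _ ht hmono =>
    truncSpline_det_nonneg hx k hmono (fun i => hl i _ (ht i)) (fun i => hr i _ (ht i)) hc

open MeasureTheory in
theorem det_setIntegral_truncSpline_nonneg (hx : Monotone x) (k : ℕ) {p : ℕ} {u v : Fin p → ℝ}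
    {c : Fin p → ℤ} (hc : StrictMono c) (hord : ∀ i i', i < i' → v i ≤ u i')
    (hl : ∀ i, ∃ l, x l ≤ u i) (hr : ∀ i, ∃ r, v i ≤ x r) :
    0 ≤ (Matrix.of fun i j => ∫ t in Set.Ioo (u i) (v i), truncSpline x k (c j) t).det :=
  det_integral_truncSpline_nonneg hx k (fun i => volume.restrict (Set.Ioo (u i) (v i)))
    (S := fun i => Set.Ioo (u i) (v i)) (fun _ => ae_restrict_mem measurableSet_Ioo)
    (fun i i' h _ hs _ ht => (hs.2.trans_le (hord i i' h)).trans ht.1)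
    (fun i _ ht => (hl i).imp fun _ h => h.trans ht.1.le)
    (fun i _ ht => (hr i).imp fun _ h => ht.2.trans_le h)
    (fun _ j => integrableOn_truncSpline k j _ _) hc

-- Induction on the order. Expansion along the last row turns the determinant into the integral of a
-- spline `g` over the last cell. This `g` is nonnegative, and its last coefficient is a smaller
-- minor, positive by induction; local linear independence then prevents `g` from vanishing
-- identically where the last cell meets the last support.
open MeasureTheory in
theorem det_setIntegral_truncSpline_pos (hx : Monotone x) (k : ℕ) {p : ℕ} {u v : Fin p → ℝ}
    {c : Fin p → ℤ} (hc : StrictMono c) (hord : ∀ i i', i < i' → v i ≤ u i')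
    (hl : ∀ i, ∃ l, x l ≤ u i) (hr : ∀ i, ∃ r, v i ≤ x r)
    (hmeet : ∀ i, max (u i) (x (c i)) < min (v i) (x (c i + (k + 2)))) :
    0 < (Matrix.of fun i j => ∫ t in Set.Ioo (u i) (v i), truncSpline x (k + 1) (c j) t).det := by
  induction p with
  | zero => simp
  | succ p ih =>
    set M : Matrix (Fin (p + 1)) (Fin (p + 1)) ℝ :=
      Matrix.of fun i j => ∫ t in Set.Ioo (u i) (v i), truncSpline x (k + 1) (c j) t with hM
    set L := Fin.last p
    let w : Fin (p + 1) → ℝ := fun j =>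
      (-1) ^ ((L : ℕ) + j) * (M.submatrix L.succAbove j.succAbove).det
    let g : ℝ → ℝ := fun t => ∑ j, w j * truncSpline x (k + 1) (c j) t
    have hwL : 0 < w L := by
      have := ih (u := fun i => u i.castSucc) (v := fun i => v i.castSucc)
        (c := fun i => c i.castSucc) (fun i j h => hc (by simpa using h))
        (fun i i' h => hord _ _ (by simpa using h)) (fun i => hl _) (fun i => hr _)
        (fun i => hmeet _)
      simp only [w, ← two_mul, pow_mul, neg_one_sq, one_pow, one_mul]
      convert this using 2
      ext i j
      simp [hM, L]
    have hdet : M.det = ∫ t in Set.Ioo (u L) (v L), g t := by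
      rw [Matrix.det_succ_row M L, integral_finsetSum]
      · refine Finset.sum_congr rfl fun j _ => ?_
        rw [integral_const_mul]
        simp only [w, hM, Matrix.of_apply]; ring
      · intro j _
        exact (integrableOn_truncSpline _ _ _ _).const_mul _
    have hg0 : ∀ t ∈ Set.Ioo (u L) (v L), 0 ≤ g t := by
      intro t ht
      -- With a Dirac mass at `t` in the last row, the determinant becomes `g t`.
      let μ : Fin (p + 1) → Measure ℝ := fun i =>
        if i = L then Measure.dirac t else volume.restrict (Set.Ioo (u i) (v i))
      have hμL : μ L = Measure.dirac t := if_pos rfl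
      have hμ : ∀ i, i ≠ L → μ i = volume.restrict (Set.Ioo (u i) (v i)) := fun i h => if_neg h
      have : ∀ i, SigmaFinite (μ i) := fun i => by
        by_cases h : i = L
        · rw [h, hμL]; infer_instance
        · rw [hμ i h]; infer_instance
      have key := det_integral_truncSpline_nonneg hx (k + 1) μ
        (S := fun i => if i = L then {t} else Set.Ioo (u i) (v i)) ?_ ?_ ?_ ?_ ?_ hc
      · rw [Matrix.det_succ_row _ L] at key
        refine key.trans_eq (Finset.sum_congr rfl fun j _ => ?_)
        simp only [Matrix.of_apply, hμL, integral_dirac, w]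
        rw [mul_right_comm]
        congr 3
        ext a b
        simp [hM, hμ _ (Fin.succAbove_ne L a)]
      · intro i
        by_cases h : i = L
        · subst h; rw [hμL, if_pos rfl]; simp [ae_dirac_eq]
        · rw [hμ i h, if_neg h]; exact ae_restrict_mem measurableSet_Ioo
      · intro i i' h s hs s' hs'
        have hs2 : s < v i := by
          rw [if_neg (h.trans_le (Fin.le_last i')).ne] at hs; exact hs.2
        have hs1 : u i' < s' := by
          split_ifs at hs' with h'
          · rw [Set.mem_singleton_iff.1 hs', h']; exact ht.1
          · exact hs'.1
        exact (hs2.trans_le (hord i i' h)).trans hs1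
      · intro i s hs
        have : u i < s := by
          split_ifs at hs with h'
          · rw [Set.mem_singleton_iff.1 hs, h']; exact ht.1
          · exact hs.1
        exact (hl i).imp fun _ h => h.trans this.le
      · intro i s hs
        have : s < v i := by
          split_ifs at hs with h'
          · rw [Set.mem_singleton_iff.1 hs, h']; exact ht.2
          · exact hs.2
        exact (hr i).imp fun _ h => this.trans_le h
      · intro i j
        by_cases h : i = L
        · rw [h, hμL]; exact integrable_dirac (by simp)
        · rw [hμ i h]; exact integrableOn_truncSpline _ _ _ _
    -- Between `y₀` and the next knot `x s` there are no knots and the last B-spline is active, so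
    -- `g` is nonzero somewhere there and continuous at that point.
    obtain ⟨y₀, hy1, hy2⟩ := exists_between (hmeet L)
    rw [max_lt_iff] at hy1
    obtain ⟨s, hs1, hs2⟩ := exists_insert_position hx ⟨c L, hy1.2.le⟩
      ⟨_, hy2.trans_le (min_le_right _ _)⟩
    have hw : y₀ < min (v L) (x s) := lt_min (hy2.trans_le (min_le_left _ _)) hs2
    have hex : ∃ y ∈ Set.Ioo y₀ (min (v L) (x s)), g y ≠ 0 := by
      by_contra! hall
      refine hwL.ne' (truncSpline_locally_linearIndependent hx (k + 1) (m := s - 1) hw hs1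
        (by simp) hc.injective hall ?_ ?_)
      · by_contra! h
        have := hx (show s ≤ c L by omega); linarith
      · by_contra! h
        have h1 := hx (show c L + (k + 2) ≤ s - 1 by push_cast at h; omega)
        have h2 := hy2.trans_le (min_le_right _ _)
        linarith
    obtain ⟨y, hy, hgy⟩ := hex
    have hyL : y ∈ Set.Ioo (u L) (v L) :=
      ⟨hy1.1.trans hy.1, hy.2.trans_le (min_le_left _ _)⟩
    have hne : ∀ i, x i ≠ y := ne_of_mem_knot_interval hx (hs1.trans_lt hy.1)
      (by simpa using hy.2.trans_le (min_le_right _ _))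
    rw [hdet]
    refine setIntegral_pos_of_continuousAt ?_ hg0 hyL ?_ ((hg0 y hyL).lt_of_ne' hgy)
    · exact integrable_finsetSum _ fun j _ => (integrableOn_truncSpline _ _ _ _).const_mul _
    · exact tendsto_finsetSum _ fun j _ =>
        (continuousAt_truncSpline k (c j) hne).const_mul _

/-! ### The collocation matrix -/

theorem iteratedDeriv_truncPow (k m : ℕ) {a y : ℝ} (h : a ≠ y) :
    iteratedDeriv m (fun t => truncPow k (t - y)) a / m.factorial = truncTaylor k y m a := by
  unfold truncTaylor
  rcases h.lt_or_gt with h | h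
  · have : (fun t => truncPow k (t - y)) =ᶠ[nhds a] fun _ => 0 := by
      filter_upwards [gt_mem_nhds h] with t ht
      rw [truncPow, if_neg (by linarith)]
    rw [this.iteratedDeriv_eq, if_neg h.le.not_gt]
    simp
  · have : (fun t => truncPow k (t - y)) =ᶠ[nhds a] fun t => (fun s => s ^ k) (t - y) := by
      filter_upwards [lt_mem_nhds h] with t ht
      rw [truncPow, if_pos (by linarith)]
    rw [this.iteratedDeriv_eq, iteratedDeriv_comp_sub_const m (fun s => s ^ k) y]
    beta_reduce
    rw [iteratedDeriv_pow, if_pos h, Nat.descFactorial_eq_factorial_mul_choose]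
    have := Nat.factorial_ne_zero m
    push_cast
    field_simp

theorem dividedDiff_congr {x x' : ℤ → ℝ} (f : ℝ → ℝ) (m : ℕ) (j : ℤ)
    (h : ∀ i : ℤ, j ≤ i → i ≤ j + m → x i = x' i) :
    dividedDiff x f m j = dividedDiff x' f m j := by
  induction m generalizing j with
  | zero => simp [dividedDiff, h j le_rfl (by simp)]
  | succ m ih =>
    rw [dividedDiff, dividedDiff, h j le_rfl (by push_cast; omega),
      h (j + (m + 1)) (by omega) (by push_cast; omega), ih j, ih (j + 1)]
    · exact fun i hi hi' => h i (by omega) (by push_cast; omega)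
    · exact fun i hi hi' => h i hi (by push_cast; omega)

/-- The knot sequence extended by constants outside of `-k, …, n + k`. -/
def clampKnots (n k : ℕ) (x : ℤ → ℝ) (i : ℤ) : ℝ := x (max (-k) (min i (n + k)))

theorem clampKnots_eq {n k : ℕ} {x : ℤ → ℝ} {i : ℤ} (h1 : -(k : ℤ) ≤ i) (h2 : i ≤ n + k) :
    clampKnots n k x i = x i := by
  rw [clampKnots, min_eq_left h2, max_eq_right h1]

theorem grevilleNode_congr {x x' : ℤ → ℝ} (k : ℕ) (j : ℤ)
    (h : ∀ i : ℤ, j < i → i ≤ j + k → x i = x' i) : grevilleNode x k j = grevilleNode x' k j := by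
  unfold grevilleNode
  congr 1
  refine Finset.sum_congr rfl fun l hl => h _ ?_ ?_ <;>
  · have := Finset.mem_Icc.1 hl
    omega

/-- Lets the knots be assumed monotone on all of `ℤ`, as the results on arbitrary knots require. -/
theorem collocationMatrix_clampKnots (n k : ℕ) (x : ℤ → ℝ) :
    collocationMatrix n k (clampKnots n k x) = collocationMatrix n k x := by
  have hg : ∀ j : ℤ, -(k : ℤ) - 1 ≤ j → j < n →
      grevilleNode (clampKnots n k x) (k + 1) j = grevilleNode x (k + 1) j := fun j h1 h2 =>
    grevilleNode_congr _ _ fun i hi hi' => clampKnots_eq (by omega) (by push_cast at hi'; omega)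
  ext i j
  have hi := i.2
  have hj := j.2
  simp only [collocationMatrix, Matrix.of_apply]
  rw [hg _ (by omega) (by omega), hg _ (by omega) (by omega)]
  congr 1
  funext t
  unfold integralBspline bspline
  rw [hg _ (by omega) (by omega), hg _ (by omega) (by omega), clampKnots_eq (by omega) (by omega),
    clampKnots_eq (by omega) (by omega), dividedDiff_congr]
  exact fun l hl hl' => clampKnots_eq (by omega) (by push_cast at hl'; omega)

namespace IsExtendedKnotSequence

variable {n k : ℕ} {x : ℤ → ℝ}

theorem clampKnots (hx : IsExtendedKnotSequence n k x) :
    IsExtendedKnotSequence n k (clampKnots n k x) where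
  left j h1 h2 := by rw [clampKnots_eq h1 (by omega), hx.left j h1 h2]
  strict j h1 h2 := by
    rw [clampKnots_eq (by omega) (by omega), clampKnots_eq (by omega) (by omega)]
    exact hx.strict j h1 h2
  right j h1 h2 := by rw [clampKnots_eq (by omega) h2, hx.right j h1 h2]

theorem clampKnots_monotone (hx : IsExtendedKnotSequence n k x) :
    Monotone (_root_.clampKnots n k x) := by
  refine monotone_int_of_le_succ fun i => ?_
  unfold _root_.clampKnots
  rcases lt_or_ge i (-k) with h | h
  · rw [show max (-(k : ℤ)) (min i (n + k)) = -k by omega,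
      show max (-(k : ℤ)) (min (i + 1) (n + k)) = -k by omega]
  rcases lt_or_ge i (n + k) with h' | h'
  · rw [show max (-(k : ℤ)) (min i (n + k)) = i by omega,
      show max (-(k : ℤ)) (min (i + 1) (n + k)) = i + 1 by omega]
    rcases lt_or_ge i 0 with h0 | h0
    · rw [hx.left i h h0.le, hx.left (i + 1) (by omega) (by omega)]
    rcases lt_or_ge i n with hn | hn
    · exact (hx.strict i h0 hn).le
    · rw [hx.right i hn h'.le, hx.right (i + 1) (by omega) (by omega)]
  · rw [show max (-(k : ℤ)) (min i (n + k)) = n + k by omega,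
      show max (-(k : ℤ)) (min (i + 1) (n + k)) = n + k by omega]

theorem knot_lt (hx : IsExtendedKnotSequence n k x) (hm : Monotone x) {a b : ℤ} (ha : a < n)
    (hb : 0 < b) (hab : a < b) (hn : 0 < n) : x a < x b :=
  ((hm (by omega)).trans_lt (hx.strict (max a 0) (by omega) (by omega))).trans_le (hm (by omega))

/-- Knots coincide only at `0` and `1`. For `y` strictly between, the truncated power is smooth near
them, so the derivatives in the confluent branch are the Taylor coefficients. -/
theorem dividedDiff_truncPow (hx : IsExtendedKnotSequence n k x) (hm : Monotone x) (hn : 0 < n)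
    {y : ℝ} (hy : y ∈ Set.Ioo (0 : ℝ) 1) (m : ℕ) (j : ℤ) (h1 : -(k : ℤ) ≤ j)
    (h2 : j + m ≤ n + k) :
    dividedDiff x (fun t => truncPow k (t - y)) m j = hermiteDiff x (truncTaylor k y) m j := by
  induction m generalizing j with
  | zero => simp [dividedDiff, hermiteDiff, truncTaylor, truncPow]
  | succ m ih =>
    push_cast at h2
    rw [dividedDiff, hermiteDiff, ih (j + 1) (by omega) (by omega), ih j h1 (by omega)]
    split_ifs with h
    · refine iteratedDeriv_truncPow k (m + 1) ?_
      rcases lt_or_ge (j + (m + 1)) 1 with h0 | h0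
      · rw [hx.left j h1 (by omega)]; exact hy.1.ne
      rcases lt_or_ge j n with h3 | h3
      · exact absurd h (hx.knot_lt hm h3 (by omega) (by omega) hn).ne'
      · rw [hx.right j h3 (by omega)]; exact hy.2.ne'
    · rfl

end IsExtendedKnotSequence

/-! ### Greville nodes and their position among the knots -/

section greville
variable {x : ℤ → ℝ}

/-- The sums telescope. Hence normalizing to integral one cancels the knot width in the B-spline and
leaves the factor `k + 1`. -/
theorem grevilleNode_sub (x : ℤ → ℝ) (k : ℕ) (j : ℤ) :
    grevilleNode x (k + 1) j - grevilleNode x (k + 1) (j - 1) = (x (j + k + 1) - x j) / (k + 1) := by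
  have h : ∀ K : ℕ, ∑ l ∈ Finset.Icc 1 K, x (j + l) - ∑ l ∈ Finset.Icc 1 K, x (j - 1 + l) =
      x (j + K) - x j := by
    intro K
    induction K with
    | zero => simp
    | succ K ih =>
      rw [Finset.sum_Icc_succ_top (by omega), Finset.sum_Icc_succ_top (by omega)]
      have : j - 1 + ((K + 1 : ℕ) : ℤ) = j + K := by push_cast; ring
      rw [this]; linarith
  unfold grevilleNode
  rw [← sub_div, h]
  push_cast
  rw [add_assoc]

theorem grevilleNode_mono (hm : Monotone x) (k : ℕ) : Monotone (grevilleNode x (k + 1)) := by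
  refine monotone_int_of_le_succ fun j => sub_nonneg.1 ?_
  have := grevilleNode_sub x k (j + 1)
  rw [add_sub_cancel_right] at this
  rw [this]
  exact div_nonneg (sub_nonneg.2 (hm (by omega))) (by positivity)

theorem le_grevilleNode (hm : Monotone x) (k : ℕ) (j : ℤ) :
    x (j + 1) ≤ grevilleNode x (k + 1) j := by
  unfold grevilleNode
  rw [le_div_iff₀ (by positivity)]
  have := Finset.card_nsmul_le_sum (Finset.Icc 1 (k + 1)) (fun l : ℕ => x (j + l)) (x (j + 1))
    fun l hl => hm (by have := Finset.mem_Icc.1 hl; omega)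
  rw [Nat.card_Icc, nsmul_eq_mul, Nat.add_sub_cancel] at this
  linarith

theorem grevilleNode_le (hm : Monotone x) (k : ℕ) (j : ℤ) :
    grevilleNode x (k + 1) j ≤ x (j + (k + 1)) := by
  unfold grevilleNode
  rw [div_le_iff₀ (by positivity)]
  have := Finset.sum_le_card_nsmul (Finset.Icc 1 (k + 1)) (fun l : ℕ => x (j + l))
    (x (j + (k + 1))) fun l hl => hm (by have := Finset.mem_Icc.1 hl; omega)
  rw [Nat.card_Icc, nsmul_eq_mul, Nat.add_sub_cancel] at this
  linarith

theorem lt_grevilleNode (hm : Monotone x) {k : ℕ} {j : ℤ} (h : x (j + 1) < x (j + (k + 1))) :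
    x (j + 1) < grevilleNode x (k + 1) j := by
  unfold grevilleNode
  rw [lt_div_iff₀ (by positivity)]
  have := Finset.sum_lt_sum (s := Finset.Icc 1 (k + 1)) (f := fun _ => x (j + 1))
    (g := fun l : ℕ => x (j + l))
    (fun l hl => hm (by have := Finset.mem_Icc.1 hl; omega))
    ⟨k + 1, by simp, by push_cast; exact h⟩
  rw [Finset.sum_const, Nat.card_Icc, nsmul_eq_mul, Nat.add_sub_cancel] at this
  linarith

theorem grevilleNode_lt (hm : Monotone x) {k : ℕ} {j : ℤ} (h : x (j + 1) < x (j + (k + 1))) :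
    grevilleNode x (k + 1) j < x (j + (k + 1)) := by
  unfold grevilleNode
  rw [div_lt_iff₀ (by positivity)]
  have := Finset.sum_lt_sum (s := Finset.Icc 1 (k + 1)) (f := fun l : ℕ => x (j + l))
    (g := fun _ => x (j + (k + 1)))
    (fun l hl => hm (by have := Finset.mem_Icc.1 hl; omega))
    ⟨1, by simp, by push_cast; exact h⟩
  rw [Finset.sum_const, Nat.card_Icc, nsmul_eq_mul, Nat.add_sub_cancel] at this
  linarith

end greville

/-! ### Minors of the collocation matrix -/

namespace IsExtendedKnotSequence

variable {n k : ℕ} {x : ℤ → ℝ}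

theorem grevilleNode_nonneg (hx : IsExtendedKnotSequence n k x) (hm : Monotone x) {j : ℤ}
    (hj : -(k : ℤ) - 1 ≤ j) : 0 ≤ grevilleNode x (k + 1) j := by
  have h1 := le_grevilleNode hm k j
  have h2 : x (-k) ≤ x (j + 1) := hm (by omega)
  rw [hx.left (-k) le_rfl (by omega)] at h2
  linarith

theorem grevilleNode_le_one (hx : IsExtendedKnotSequence n k x) (hm : Monotone x) {j : ℤ}
    (hj : j < n) : grevilleNode x (k + 1) j ≤ 1 := by
  have h1 := grevilleNode_le hm k j
  have h2 : x (j + (k + 1)) ≤ x (n + k) := hm (by omega)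
  rw [hx.right (n + k) (by omega) le_rfl] at h2
  linarith

theorem collocationMatrix_apply (hx : IsExtendedKnotSequence n k x) (hm : Monotone x)
    (hn : 0 < n) (i j : Fin (n + k)) :
    collocationMatrix n k x i j = (k + 1) *
      ∫ t in Set.Ioo (grevilleNode x (k + 1) ((i : ℤ) - k - 1))
        (grevilleNode x (k + 1) ((i : ℤ) - k)), truncSpline x k ((j : ℤ) - k) t := by
  have hi := i.2
  have hj := j.2
  simp only [collocationMatrix, Matrix.of_apply]
  rw [intervalIntegral.integral_of_le (grevilleNode_mono hm k (by omega)),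
    MeasureTheory.integral_Ioc_eq_integral_Ioo, ← MeasureTheory.integral_const_mul]
  refine MeasureTheory.setIntegral_congr_fun measurableSet_Ioo fun t ht => ?_
  have ht' : t ∈ Set.Ioo (0 : ℝ) 1 :=
    ⟨(hx.grevilleNode_nonneg hm (by omega)).trans_lt ht.1,
      ht.2.trans_le (hx.grevilleNode_le_one hm (by omega))⟩
  have hlt : x ((j : ℤ) - k) < x ((j : ℤ) - k + k + 1) :=
    hx.knot_lt hm (by omega) (by omega) (by omega) hn
  have := sub_pos.2 hlt
  simp only [integralBspline, bspline, grevilleNode_sub]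
  rw [hx.dividedDiff_truncPow hm hn ht' (k + 1) _ (by omega) (by push_cast; omega)]
  unfold truncSpline
  field_simp

theorem det_submatrix_collocationMatrix (hx : IsExtendedKnotSequence n k x) (hm : Monotone x)
    (hn : 0 < n) {p : ℕ} (r c : Fin p → Fin (n + k)) :
    ((collocationMatrix n k x).submatrix r c).det = (k + 1) ^ p *
      (Matrix.of fun i j : Fin p => ∫ t in Set.Ioo (grevilleNode x (k + 1) ((r i : ℤ) - k - 1))
        (grevilleNode x (k + 1) ((r i : ℤ) - k)), truncSpline x k ((c j : ℤ) - k) t).det := by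
  have := Matrix.det_smul (Matrix.of fun i j : Fin p =>
    ∫ t in Set.Ioo (grevilleNode x (k + 1) ((r i : ℤ) - k - 1))
      (grevilleNode x (k + 1) ((r i : ℤ) - k)), truncSpline x k ((c j : ℤ) - k) t) ((k : ℝ) + 1)
  rw [Fintype.card_fin] at this
  rw [← this]
  congr 1
  ext i j
  simp [hx.collocationMatrix_apply hm hn]

theorem collocationMatrix_isTotallyNonneg (hx : IsExtendedKnotSequence n k x) (hm : Monotone x)
    (hn : 0 < n) : (collocationMatrix n k x).IsTotallyNonneg := by
  intro p r c
  rw [hx.det_submatrix_collocationMatrix hm hn]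
  refine mul_nonneg (by positivity) (det_setIntegral_truncSpline_nonneg hm k
    (c := fun j => (c j : ℤ) - k) (fun j j' h => ?_) (fun i i' h => ?_) (fun i => ⟨-k, ?_⟩)
    (fun i => ⟨n + k, ?_⟩))
  · have := c.strictMono h
    simp only [Fin.lt_def] at this
    simp only; omega
  · have := r.strictMono h
    simp only [Fin.lt_def] at this
    exact grevilleNode_mono hm k (by omega)
  · rw [hx.left _ le_rfl (by omega)]; exact hx.grevilleNode_nonneg hm (by omega)
  · rw [hx.right _ (by omega) le_rfl]
    exact hx.grevilleNode_le_one hm (by have := (r i).2; omega)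

/-- Each cell meets the support paired with it. In the extreme cases of index difference one, an end
of the cell is the mean of `k + 1` knots that has to lie strictly beyond the smallest or below the
largest of them; these knots are not all equal because `k ≥ 1`. -/
theorem collocationMatrix_minor_pos (hx : IsExtendedKnotSequence n k x) (hm : Monotone x)
    (hn : 0 < n) (hk : 0 < k) {p : ℕ} (r c : Fin p ↪o Fin (n + k))
    (hrc : ∀ i, (r i : ℕ) ≤ c i + 1 ∧ (c i : ℕ) ≤ r i + 1) :
    0 < ((collocationMatrix n k x).submatrix r c).det := by
  rw [hx.det_submatrix_collocationMatrix hm hn]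
  refine mul_pos (by positivity) ?_
  obtain ⟨k', rfl⟩ : ∃ k', k = k' + 1 := ⟨k - 1, by omega⟩
  refine det_setIntegral_truncSpline_pos hm k'
    (c := fun j => (c j : ℤ) - (k' + 1 : ℕ)) (fun j j' h => ?_) (fun i i' h => ?_)
    (fun i => ⟨-(k' + 1 : ℕ), ?_⟩) (fun i => ⟨n + (k' + 1 : ℕ), ?_⟩) (fun i => ?_)
  · have := c.strictMono h
    simp only [Fin.lt_def] at this
    simp only; omega
  · have := r.strictMono h
    simp only [Fin.lt_def] at this
    exact grevilleNode_mono hm _ (by omega)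
  · rw [hx.left _ le_rfl (by omega)]; exact hx.grevilleNode_nonneg hm (by omega)
  · rw [hx.right _ (by omega) le_rfl]
    exact hx.grevilleNode_le_one hm (by have := (r i).2; omega)
  · have hr := (r i).2
    have hc := (c i).2
    obtain ⟨h1, h2⟩ := hrc i
    generalize (r i : ℕ) = a at hr h1 h2 ⊢
    generalize (c i : ℕ) = b at hc h1 h2 ⊢
    have hξ : grevilleNode x (k' + 1 + 1) ((a : ℤ) - (k' + 1 : ℕ) - 1) < grevilleNode x (k' + 1 + 1) ((a : ℤ) - (k' + 1 : ℕ)) := by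
      rw [← sub_pos, grevilleNode_sub]
      exact div_pos (sub_pos.2 (hx.knot_lt hm (by omega) (by omega) (by omega) hn)) (by positivity)
    have hxx : x ((b : ℤ) - (k' + 1 : ℕ)) < x ((b : ℤ) - (k' + 1 : ℕ) + (k' + 2)) :=
      hx.knot_lt hm (by omega) (by omega) (by omega) hn
    have u1 : grevilleNode x (k' + 1 + 1) ((a : ℤ) - (k' + 1 : ℕ) - 1) < x ((b : ℤ) - (k' + 1 : ℕ) + (k' + 2)) := by
      rcases le_or_gt a b with hab | hab
      · refine hξ.trans_le ((grevilleNode_le hm _ _).trans (hm (by omega)))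
      · refine (grevilleNode_lt hm ?_).trans_le (hm (by omega))
        exact hx.knot_lt hm (by omega) (by omega) (by omega) hn
    have u2 : x ((b : ℤ) - (k' + 1 : ℕ)) < grevilleNode x (k' + 1 + 1) ((a : ℤ) - (k' + 1 : ℕ)) := by
      rcases le_or_gt b a with hab | hab
      · refine ((hm (by omega)).trans (le_grevilleNode hm _ ((a : ℤ) - (k' + 1 : ℕ) - 1))).trans_lt hξ
      · refine (hm (by omega)).trans_lt (lt_grevilleNode hm ?_)
        exact hx.knot_lt hm (by omega) (by omega) (by omega) hn
    exact max_lt (lt_min hξ u1) (lt_min u2 hxx)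

end IsExtendedKnotSequence

/-! ### Compound matrices -/

section compound
variable {R : Type*} [CommRing R] {N : ℕ}

/-- The `p`-th compound matrix, whose entries are the minors of order `p`. -/
def Matrix.compound (p : ℕ) (A : Matrix (Fin N) (Fin N) R) :
    Matrix (Fin p ↪o Fin N) (Fin p ↪o Fin N) R :=
  Matrix.of fun r c => (A.submatrix r c).det

theorem Matrix.compound_apply (p : ℕ) (A : Matrix (Fin N) (Fin N) R) (r c : Fin p ↪o Fin N) :
    A.compound p r c = (A.submatrix r c).det := rfl

/-- An injective map from `Fin p` is uniquely an order embedding after a permutation. -/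
theorem Fin.bijective_orderEmbedding_comp_perm {p : ℕ} :
    Function.Bijective fun (q : (Fin p ↪o Fin N) × Equiv.Perm (Fin p)) =>
      (⟨q.1 ∘ q.2, q.1.injective.comp q.2.injective⟩ :
        {f : Fin p → Fin N // Function.Injective f}) := by
  constructor
  · rintro ⟨s, σ⟩ ⟨s', σ'⟩ h
    have h1 : s ∘ σ = s' ∘ σ' := congrArg Subtype.val h
    have hr : Set.range s = Set.range s' := by
      rw [← σ.surjective.range_comp s, h1, σ'.surjective.range_comp s']
    have hs : s = s' := OrderEmbedding.range_inj.1 hr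
    subst hs
    refine Prod.ext rfl (Equiv.ext fun i => s.injective (congrFun h1 i))
  · rintro ⟨f, hf⟩
    let σ := Tuple.sort f
    have hm : StrictMono (f ∘ σ) := (Tuple.monotone_sort f).strictMono_of_injective
      (hf.comp σ.injective)
    refine ⟨(OrderEmbedding.ofStrictMono _ hm, σ⁻¹), Subtype.ext (funext fun i => ?_)⟩
    simp

/-- The Cauchy–Binet formula. -/
theorem Matrix.compound_mul (p : ℕ) (A B : Matrix (Fin N) (Fin N) R) :
    (A * B).compound p = A.compound p * B.compound p := by
  ext r c
  rw [Matrix.mul_apply, compound_apply, Matrix.det_apply']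
  have h1 : ∀ σ : Equiv.Perm (Fin p), ∏ i, ((A * B).submatrix r c) (σ i) i =
      ∑ f : Fin p → Fin N, ∏ i, A (r (σ i)) (f i) * B (f i) (c i) := by
    intro σ
    simp only [Matrix.submatrix_apply, Matrix.mul_apply]
    rw [Finset.prod_univ_sum]
    simp
  have h2 : ∀ f : Fin p → Fin N, ∑ σ : Equiv.Perm (Fin p), ((Equiv.Perm.sign σ : ℤ) : R) *
      ∏ i, A (r (σ i)) (f i) * B (f i) (c i) =
      (A.submatrix r f).det * ∏ i, B (f i) (c i) := by
    intro f
    rw [Matrix.det_apply', Finset.sum_mul]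
    refine Finset.sum_congr rfl fun σ _ => ?_
    rw [Finset.prod_mul_distrib, mul_assoc]; rfl
  simp only [h1, Finset.mul_sum]
  rw [Finset.sum_comm]
  simp only [h2]
  -- A non-injective `f` repeats a column. Injective ones split into an order embedding and a
  -- permutation, whose sign rebuilds the minor of `B`.
  have h3 : ∑ f : Fin p → Fin N, (A.submatrix r f).det * ∏ i, B (f i) (c i) =
      ∑ f : {f : Fin p → Fin N // Function.Injective f},
        (A.submatrix r f.1).det * ∏ i, B (f.1 i) (c i) := by
    classical
    rw [← Finset.sum_filter_of_ne (p := Function.Injective)]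
    · exact Finset.sum_subtype _ (by simp) _
    · intro f _ hf
      by_contra hni
      simp only [Function.Injective, not_forall] at hni
      obtain ⟨a, b, hab, hne⟩ := hni
      exact hf (by rw [Matrix.det_zero_of_column_eq hne (by simp [hab]), zero_mul])
  rw [h3, ← (Fin.bijective_orderEmbedding_comp_perm (N := N) (p := p)).sum_comp,
    Fintype.sum_prod_type]
  refine Finset.sum_congr rfl fun s _ => ?_
  rw [compound_apply, compound_apply, Matrix.det_apply' (B.submatrix s c), Finset.mul_sum]
  refine Finset.sum_congr rfl fun σ _ => ?_
  have h4 := Matrix.det_permute' σ (A.submatrix r s)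
  rw [Matrix.submatrix_submatrix] at h4
  change (A.submatrix r (s ∘ σ)).det * _ = _
  rw [Function.comp_id] at h4
  rw [h4, mul_comm _ (A.submatrix r s).det, mul_assoc]
  rfl

theorem Matrix.compound_one (p : ℕ) : (1 : Matrix (Fin N) (Fin N) R).compound p = 1 := by
  ext r c
  rw [compound_apply]
  by_cases h : r = c
  · subst h
    rw [Matrix.submatrix_one _ r.injective, Matrix.det_one, Matrix.one_apply_eq]
  · rw [Matrix.one_apply_ne h]
    obtain ⟨a, ha⟩ : ∃ a, c a ∉ Set.range r := by
      by_contra! hall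
      have hs : Set.range c ⊆ Set.range r := by rintro _ ⟨a, rfl⟩; exact hall a
      refine h (OrderEmbedding.range_inj.1 (Set.eq_of_subset_of_ncard_le hs ?_).symm)
      rw [Set.ncard_range_of_injective r.injective, Set.ncard_range_of_injective c.injective]
    refine Matrix.det_eq_zero_of_column_eq_zero a fun i => ?_
    exact Matrix.one_apply_ne fun he => ha ⟨i, he⟩

theorem Matrix.compound_map {S : Type*} [CommRing S] (f : R →+* S) (p : ℕ)
    (A : Matrix (Fin N) (Fin N) R) : (A.map f).compound p = (A.compound p).map f := by
  ext r c
  simp only [compound_apply, Matrix.map_apply, RingHom.map_det]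
  rfl

end compound

/-! ### Powers of totally nonnegative matrices -/

theorem Matrix.IsTotallyNonneg.pow {N : ℕ} {A : Matrix (Fin N) (Fin N) ℝ}
    (hA : A.IsTotallyNonneg) (m : ℕ) : (A ^ m).IsTotallyNonneg := by
  intro p
  induction m with
  | zero =>
    intro r c
    rw [pow_zero, ← Matrix.compound_apply, Matrix.compound_one, Matrix.one_apply]
    split_ifs <;> simp
  | succ m ih =>
    intro r c
    rw [pow_succ', ← Matrix.compound_apply, Matrix.compound_mul, Matrix.mul_apply]
    exact Finset.sum_nonneg fun s _ => mul_nonneg (hA p r s) (ih s c)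

/-- All Cauchy–Binet terms are nonnegative, so one positive term suffices: its intermediate index
set moves every index of `r` by at most one towards `c`. -/
theorem Matrix.IsTotallyNonneg.pow_minor_pos {N : ℕ} {A : Matrix (Fin N) (Fin N) ℝ}
    (hA : A.IsTotallyNonneg)
    (hpos : ∀ (p : ℕ) (r c : Fin p ↪o Fin N),
      (∀ i, (r i : ℕ) ≤ c i + 1 ∧ (c i : ℕ) ≤ r i + 1) → 0 < (A.submatrix r c).det)
    (m p : ℕ) (r c : Fin p ↪o Fin N)
    (hrc : ∀ i, (r i : ℕ) ≤ c i + m ∧ (c i : ℕ) ≤ r i + m) :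
    0 < ((A ^ m).submatrix r c).det := by
  induction m generalizing r with
  | zero =>
    obtain rfl : r = c := by
      ext i; have := hrc i; omega
    rw [pow_zero, ← Matrix.compound_apply, Matrix.compound_one, Matrix.one_apply_eq]
    exact one_pos
  | succ m ih =>
    rw [pow_succ', ← Matrix.compound_apply, Matrix.compound_mul, Matrix.mul_apply]
    -- `c i` clamped to within one of `r i`; truncated subtraction at `r i = 0` does no harm.
    -- Clamping keeps strict monotonicity.
    let f : Fin p → Fin N := fun i => ⟨max ((r i : ℕ) - 1) (min (c i) (r i + 1)), by
      have := (r i).2; have := (c i).2; omega⟩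
    have hf : StrictMono f := fun i j hij => by
      have h1 := r.strictMono hij
      have h2 := c.strictMono hij
      simp only [Fin.lt_def, f] at h1 h2 ⊢
      omega
    refine Finset.sum_pos' (fun s _ => mul_nonneg (hA p r s) (hA.pow m p s c))
      ⟨OrderEmbedding.ofStrictMono f hf, Finset.mem_univ _, mul_pos (hpos p _ _ fun i => ?_)
        (ih _ fun i => ?_)⟩
    · change _ ≤ max ((r i : ℕ) - 1) (min (c i) (r i + 1)) + 1 ∧
        max ((r i : ℕ) - 1) (min (c i) (r i + 1)) ≤ _
      omega
    · have := hrc i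
      change max ((r i : ℕ) - 1) (min (c i) (r i + 1)) ≤ _ ∧
        _ ≤ max ((r i : ℕ) - 1) (min (c i) (r i + 1)) + _
      omega

theorem Matrix.IsTotallyNonneg.pow_isStrictlyTotallyPos {N : ℕ} {A : Matrix (Fin N) (Fin N) ℝ}
    (hA : A.IsTotallyNonneg)
    (hpos : ∀ (p : ℕ) (r c : Fin p ↪o Fin N),
      (∀ i, (r i : ℕ) ≤ c i + 1 ∧ (c i : ℕ) ≤ r i + 1) → 0 < (A.submatrix r c).det)
    {m : ℕ} (hm : N ≤ m) : (A ^ m).IsStrictlyTotallyPos := fun p r c =>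
  hA.pow_minor_pos hpos m p r c fun i => by
    have := (r i).2; have := (c i).2; omega

/-! ### Perron's theorem for positive matrices -/

section perron
variable {ι : Type*} [Fintype ι] {P : Matrix ι ι ℝ}

open Matrix

/-- Collatz–Wielandt: maximize `ρ` subject to `ρ w ≤ P w` over the simplex. The sum `T` of all
entries bounds `ρ`, which gives compactness. If the inequality were strict in one coordinate,
applying `P` would make it strict in all and allow a larger `ρ`. -/
theorem Matrix.exists_pos_eigenvector [Nonempty ι] (hP : ∀ i j, 0 < P i j) :
    ∃ (ρ : ℝ) (w : ι → ℝ), 0 < ρ ∧ (∀ i, 0 < w i) ∧ P *ᵥ w = ρ • w := by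
  classical
  have hmul : ∀ v : ι → ℝ, (∀ i, 0 ≤ v i) → (∃ i, 0 < v i) → ∀ i, 0 < (P *ᵥ v) i := by
    rintro v hv ⟨j, hj⟩ i
    exact Finset.sum_pos' (fun l _ => mul_nonneg (hP i l).le (hv l))
      ⟨j, Finset.mem_univ _, mul_pos (hP i j) hj⟩
  set T : ℝ := ∑ i, ∑ j, P i j
  let K : Set ((ι → ℝ) × ℝ) := (stdSimplex ℝ ι ×ˢ Set.Icc 0 T) ∩
    {q | ∀ i, q.2 * q.1 i ≤ (P *ᵥ q.1) i}
  have hcont : ∀ i, Continuous fun q : (ι → ℝ) × ℝ => (P *ᵥ q.1) i := fun i => by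
    simp only [Matrix.mulVec, dotProduct]; fun_prop
  have hK : IsCompact K := by
    refine ((isCompact_stdSimplex ℝ ι).prod isCompact_Icc).inter_right ?_
    simp only [Set.ofPred_forall]
    exact isClosed_iInter fun i => isClosed_le (by fun_prop) (hcont i)
  have hne : K.Nonempty := by
    obtain ⟨i⟩ := ‹Nonempty ι›
    refine ⟨(Pi.single i 1, 0), ⟨single_mem_stdSimplex ℝ i, le_rfl,
      Finset.sum_nonneg fun i _ => Finset.sum_nonneg fun j _ => (hP i j).le⟩, fun l => ?_⟩
    simpa using (hP l i).le
  obtain ⟨⟨w, ρ⟩, ⟨⟨⟨hw0, hw1⟩, hρ0, hρT⟩, hwρ⟩, hmax⟩ := hK.exists_isMaxOn hne continuousOn_snd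
  simp only [Set.mem_ofPred_eq] at hwρ
  have hwex : ∃ i, 0 < w i := by
    by_contra! h
    have : ∑ i, w i ≤ 0 := Finset.sum_nonpos fun i _ => h i
    linarith
  have hz := hmul w hw0 hwex
  have heq : ∀ i, (P *ᵥ w) i = ρ * w i := by
    by_contra! hex
    obtain ⟨i₀, hi₀⟩ := hex
    have hd : ∀ i, 0 < (P *ᵥ (P *ᵥ w - ρ • w)) i :=
      hmul _ (fun i => by simpa using hwρ i)
        ⟨i₀, by simpa using lt_of_le_of_ne (hwρ i₀) hi₀.symm⟩
    set z := P *ᵥ w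
    have hd' : ∀ i, ρ * z i < (P *ᵥ z) i := fun i => by
      have := hd i
      rw [Matrix.mulVec_sub, Matrix.mulVec_smul] at this
      simpa using this
    obtain ⟨i₁, -, hi₁⟩ := Finset.exists_min_image Finset.univ (fun i => (P *ᵥ z) i / z i)
      Finset.univ_nonempty
    set ρ' := (P *ᵥ z) i₁ / z i₁ with hρ'
    have hlt : ρ < ρ' := by rw [hρ', lt_div_iff₀ (hz i₁)]; exact hd' i₁
    have hS : 0 < ∑ i, z i := Finset.sum_pos (fun i _ => hz i) Finset.univ_nonempty
    set S := ∑ i, z i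
    have hz1 : ∑ i, (S⁻¹ • z) i = 1 := by
      simp only [Pi.smul_apply, smul_eq_mul, ← Finset.mul_sum]
      exact inv_mul_cancel₀ hS.ne'
    have hz0 : ∀ i, 0 ≤ (S⁻¹ • z) i := fun i => mul_nonneg (inv_nonneg.2 hS.le) (hz i).le
    have hle : ∀ i, ρ' * (S⁻¹ • z) i ≤ (P *ᵥ (S⁻¹ • z)) i := fun i => by
      have := hi₁ i (Finset.mem_univ i)
      rw [le_div_iff₀ (hz i)] at this
      rw [Matrix.mulVec_smul]
      simp only [Pi.smul_apply, smul_eq_mul]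
      have := mul_le_mul_of_nonneg_left this (inv_nonneg.2 hS.le)
      linarith
    have hzle : ∀ j, (S⁻¹ • z) j ≤ 1 := fun j => by
      rw [← hz1]; exact Finset.single_le_sum (fun i _ => hz0 i) (Finset.mem_univ j)
    have hT : ρ' ≤ T := by
      calc ρ' = ∑ i, ρ' * (S⁻¹ • z) i := by rw [← Finset.mul_sum, hz1, mul_one]
        _ ≤ ∑ i, (P *ᵥ (S⁻¹ • z)) i := Finset.sum_le_sum fun i _ => hle i
        _ ≤ T := Finset.sum_le_sum fun i _ => Finset.sum_le_sum fun j _ =>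
          mul_le_of_le_one_right (hP i j).le (hzle j)
    have := hmax (show (S⁻¹ • z, ρ') ∈ K from ⟨⟨⟨hz0, hz1⟩, hρ0.trans hlt.le, hT⟩, hle⟩)
    simp only [Set.mem_ofPred_eq] at this
    linarith
  have hpos : ∀ i, 0 < ρ * w i := fun i => heq i ▸ hz i
  have hρ : 0 < ρ := by
    obtain ⟨i, hi⟩ := hwex
    exact pos_of_mul_pos_left (hpos i) hi.le
  exact ⟨ρ, w, hρ, fun i => pos_of_mul_pos_right (hpos i) hρ.le, funext fun i => by simp [heq]⟩

/-- Subtract the largest multiple of `w` that keeps the difference nonnegative. One coordinate of it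
vanishes, and the positive row of `P` there forces the others to vanish. -/
theorem Matrix.eigenvector_unique_of_pos [Nonempty ι] (hP : ∀ i j, 0 < P i j) {ρ : ℝ}
    {w a : ι → ℝ} (hw : ∀ i, 0 < w i) (hPw : P *ᵥ w = ρ • w) (hPa : P *ᵥ a = ρ • a) :
    ∃ t : ℝ, a = t • w := by
  obtain ⟨i₀, -, hi₀⟩ := Finset.exists_min_image Finset.univ (fun i => a i / w i)
    Finset.univ_nonempty
  set t := a i₀ / w i₀ with ht
  have h0 : ∀ i, 0 ≤ (a - t • w) i := fun i => by
    have := hi₀ i (Finset.mem_univ i)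
    rw [le_div_iff₀ (hw i)] at this
    simpa using this
  have h1 : (P *ᵥ (a - t • w)) i₀ = 0 := by
    rw [Matrix.mulVec_sub, Matrix.mulVec_smul, hPa, hPw]
    have := (hw i₀).ne'
    simp only [Pi.sub_apply, Pi.smul_apply, smul_eq_mul, ht]
    field_simp
    ring
  refine ⟨t, funext fun j => ?_⟩
  have h2 := (Finset.sum_eq_zero_iff_of_nonneg
    (fun j _ => mul_nonneg (hP i₀ j).le (h0 j))).1 h1 j (Finset.mem_univ j)
  have := (mul_eq_zero.1 h2).resolve_left (hP i₀ j).ne'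
  simpa [sub_eq_zero] using this

/-- The Perron eigenvalue of a positive matrix: it is an eigenvalue, every other eigenvalue
is strictly smaller in absolute value, and it is simple. -/
theorem Matrix.exists_perron_eigenvalue [Nonempty ι] (hP : ∀ i j, 0 < P i j) :
    ∃ ρ : ℝ, 0 < ρ ∧
      (∃ w : ι → ℂ, w ≠ 0 ∧ P.map Complex.ofReal *ᵥ w = (ρ : ℂ) • w) ∧
      (∀ (μ : ℂ) (v : ι → ℂ), v ≠ 0 → P.map Complex.ofReal *ᵥ v = μ • v → ρ ≤ ‖μ‖ → μ = ρ) ∧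
      (∀ (v v' : ι → ℂ) (γ : ℂ), v ≠ 0 → P.map Complex.ofReal *ᵥ v = (ρ : ℂ) • v →
        P.map Complex.ofReal *ᵥ v' = (ρ : ℂ) • v' + γ • v → ∃ a : ℂ, v' = a • v) := by
  obtain ⟨ρ, w, hρ, hw, hPw⟩ := Matrix.exists_pos_eigenvector hP
  obtain ⟨ρ', l, hρ', hl, hPl⟩ := Matrix.exists_pos_eigenvector (P := Pᵀ) fun i j => hP j i
  have hPl' : l ᵥ* P = ρ' • l := by rw [← Matrix.mulVec_transpose, hPl]
  have hlw : 0 < l ⬝ᵥ w := Finset.sum_pos (fun i _ => mul_pos (hl i) (hw i)) Finset.univ_nonempty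
  obtain rfl : ρ = ρ' := by
    have := Matrix.dotProduct_mulVec l P w
    rw [hPw, hPl', dotProduct_smul, smul_dotProduct, smul_eq_mul, smul_eq_mul] at this
    exact mul_right_cancel₀ hlw.ne' this
  have hPwC : P.map Complex.ofReal *ᵥ (fun i => (w i : ℂ)) = (ρ : ℂ) • fun i => (w i : ℂ) := by
    funext i
    have := congrArg Complex.ofReal (congrFun hPw i)
    simpa [Matrix.mulVec, dotProduct] using this
  have key : ∀ (μ : ℂ) (v : ι → ℂ), v ≠ 0 → P.map Complex.ofReal *ᵥ v = μ • v → ρ ≤ ‖μ‖ →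
      μ = ρ ∧ ∃ a : ℂ, a ≠ 0 ∧ v = a • fun i => (w i : ℂ) := by
    intro μ v hv hPv hμ
    have hrow : ∀ i, ∑ j, (P i j : ℂ) * v j = μ * v i := fun i => by
      simpa [Matrix.mulVec, dotProduct] using congrFun hPv i
    let a : ι → ℝ := fun i => ‖v i‖
    have hge : ∀ i, ‖μ‖ * a i ≤ (P *ᵥ a) i := fun i => by
      rw [← norm_mul, ← hrow i]
      refine (norm_sum_le _ _).trans_eq (Finset.sum_congr rfl fun j _ => ?_)
      rw [norm_mul, Complex.norm_real, Real.norm_of_nonneg (hP i j).le]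
    have hge' : ∀ i, ρ * a i ≤ (P *ᵥ a) i := fun i =>
      (mul_le_mul_of_nonneg_right hμ (norm_nonneg _)).trans (hge i)
    -- The positive left eigenvector annihilates the nonnegative vector `P |v| - ρ |v|`, which is
    -- therefore zero.
    have hsum : ∑ i, l i * ((P *ᵥ a) i - ρ * a i) = 0 := by
      have := Matrix.dotProduct_mulVec l P a
      rw [hPl', smul_dotProduct] at this
      simp only [mul_sub, Finset.sum_sub_distrib]
      rw [sub_eq_zero]
      refine this.trans ?_
      simp only [dotProduct, smul_eq_mul, Finset.mul_sum]
      exact Finset.sum_congr rfl fun i _ => by ring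
    have hPa : ∀ i, (P *ᵥ a) i = ρ * a i := fun i => by
      have := (Finset.sum_eq_zero_iff_of_nonneg (fun i _ => mul_nonneg (hl i).le
        (sub_nonneg.2 (hge' i)))).1 hsum i (Finset.mem_univ i)
      linarith [(mul_eq_zero.1 this).resolve_left (hl i).ne']
    obtain ⟨t, ht⟩ := Matrix.eigenvector_unique_of_pos hP hw hPw
      (a := a) (funext fun i => by simp [hPa])
    have ht' : ∀ i, ‖v i‖ = t * w i := fun i => congrFun ht i
    have htne : t ≠ 0 := by
      rintro rfl
      exact hv (funext fun i => norm_eq_zero.1 (by simp [ht' i]))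
    obtain ⟨i⟩ := ‹Nonempty ι›
    have hai : 0 < ‖v i‖ := lt_of_le_of_ne (norm_nonneg _)
      (by rw [ht' i]; exact (mul_ne_zero htne (hw i).ne').symm)
    have hμ0 : 0 < ‖μ‖ := hρ.trans_le hμ
    have hb : 0 < ‖μ * v i‖ := by rw [norm_mul]; positivity
    -- The rotation `θ` makes `μ * v i` positive; equality in the triangle inequality then makes
    -- every `θ * v j` real and nonnegative.
    set θ : ℂ := (starRingEnd ℂ) (μ * v i) / ‖μ * v i‖ with hθ
    have hθn : ‖θ‖ = 1 := by
      rw [hθ, norm_div, RCLike.norm_conj, Complex.norm_real, norm_norm, div_self hb.ne']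
    have hθ1 : θ * (μ * v i) = ‖μ * v i‖ := by
      have hbc : (‖μ * v i‖ : ℂ) ≠ 0 := by exact_mod_cast hb.ne'
      rw [hθ, div_mul_eq_mul_div, mul_comm, Complex.mul_conj, Complex.normSq_eq_norm_sq]
      field_simp
      push_cast; ring
    have hre : ∑ j, P i j * (‖v j‖ - (θ * v j).re) = 0 := by
      have h1 := hθ1
      rw [← hrow i, Finset.mul_sum] at h1
      have h2 := congrArg Complex.re h1
      rw [Complex.re_sum, hrow i, Complex.ofReal_re] at h2
      have h3 : ∑ j, P i j * (θ * v j).re = ‖μ * v i‖ := by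
        rw [← h2]
        refine Finset.sum_congr rfl fun j _ => ?_
        rw [mul_left_comm, Complex.re_ofReal_mul]
      have h4 : ∑ j, P i j * ‖v j‖ ≤ ‖μ * v i‖ := by
        rw [norm_mul]
        exact (hPa i).le.trans (mul_le_mul_of_nonneg_right hμ (norm_nonneg _))
      have h5 : ∀ j ∈ Finset.univ, 0 ≤ P i j * (‖v j‖ - (θ * v j).re) := fun j _ =>
        mul_nonneg (hP i j).le (sub_nonneg.2 ((Complex.re_le_norm _).trans_eq (by simp [hθn])))
      refine le_antisymm ?_ (Finset.sum_nonneg h5)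
      simp only [mul_sub, Finset.sum_sub_distrib]
      linarith
    have hv' : ∀ j, θ * v j = (t * w j : ℝ) := fun j => by
      have h1 := (Finset.sum_eq_zero_iff_of_nonneg fun j _ => mul_nonneg (hP i j).le
        (sub_nonneg.2 ((Complex.re_le_norm (θ * v j)).trans_eq (by simp [hθn])))).1 hre j
        (Finset.mem_univ j)
      have h2 := (mul_eq_zero.1 h1).resolve_left (hP i j).ne'
      have h3 : (θ * v j).re = ‖θ * v j‖ := by rw [norm_mul, hθn, one_mul]; linarith
      have h4 := Complex.eq_re_of_ofReal_le (Complex.re_eq_norm.1 h3)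
      rw [h4, h3, norm_mul, hθn, one_mul, ht' j]
    have hθ0 : θ ≠ 0 := norm_ne_zero_iff.1 (by rw [hθn]; exact one_ne_zero)
    have hvw : v = (θ⁻¹ * t) • fun i => (w i : ℂ) := by
      funext j
      have := hv' j
      push_cast at this
      simp only [Pi.smul_apply, smul_eq_mul]
      rw [mul_assoc, ← this, inv_mul_cancel_left₀ hθ0]
    refine ⟨?_, θ⁻¹ * t, mul_ne_zero (inv_ne_zero hθ0) (by exact_mod_cast htne), hvw⟩
    have h1 : μ • v = (ρ : ℂ) • v := by
      rw [← hPv, hvw, Matrix.mulVec_smul, hPwC, smul_comm]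
    exact mul_right_cancel₀ (norm_pos_iff.1 hai) (congrFun h1 i)
  have hw0 : (fun i => (w i : ℂ)) ≠ 0 := fun h => by
    obtain ⟨i⟩ := ‹Nonempty ι›
    exact (hw i).ne' (Complex.ofReal_eq_zero.1 (congrFun h i))
  refine ⟨ρ, hρ, ⟨_, hw0, hPwC⟩, fun μ v hv h1 h2 => (key μ v hv h1 h2).1, ?_⟩
  intro v v' γ hv hPv hPv'
  have hnorm : ρ ≤ ‖(ρ : ℂ)‖ := by rw [Complex.norm_real]; exact le_abs_self ρ
  obtain ⟨-, a, ha, hva⟩ := key ρ v hv hPv hnorm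
  -- Pairing with the left eigenvector excludes a Jordan chain above `v`.
  have hγ : γ = 0 := by
    let lc : ι → ℂ := fun i => (l i : ℂ)
    have hlc : lc ᵥ* P.map Complex.ofReal = (ρ : ℂ) • lc := by
      funext i
      have := congrArg Complex.ofReal (congrFun hPl' i)
      simpa [Matrix.vecMul, dotProduct, lc] using this
    have h1 := Matrix.dotProduct_mulVec lc (P.map Complex.ofReal) v'
    rw [hPv', hlc, dotProduct_add, dotProduct_smul, smul_dotProduct, dotProduct_smul, hva,
      dotProduct_smul] at h1
    have h2 : lc ⬝ᵥ (fun i => (w i : ℂ)) ≠ 0 := by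
      have : lc ⬝ᵥ (fun i => (w i : ℂ)) = ((l ⬝ᵥ w : ℝ) : ℂ) := by simp [dotProduct, lc]
      rw [this]; exact_mod_cast hlw.ne'
    simpa [ha, h2] using h1
  rw [hγ, zero_smul, add_zero] at hPv'
  by_cases hv' : v' = 0
  · exact ⟨0, by simp [hv']⟩
  obtain ⟨-, a', -, hva'⟩ := key ρ v' hv' hPv' hnorm
  exact ⟨a' * a⁻¹, by rw [hva', hva, smul_smul, inv_mul_cancel_right₀ ha]⟩

end perron

/-! ### Triangularization -/

/-- The range of `f - μ` lies in a hyperplane, which is then invariant; induct there and add a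
vector outside it. Taking `μ` of least modulus orders the diagonal, since the later entries are
again eigenvalues of `f`. -/
theorem Module.End.exists_basis_triangular (N : ℕ) {V : Type*} [AddCommGroup V] [Module ℂ V]
    [FiniteDimensional ℂ V] (hN : Module.finrank ℂ V = N) (f : Module.End ℂ V) :
    ∃ (b : Module.Basis (Fin N) ℂ V) (T : Matrix (Fin N) (Fin N) ℂ),
      (∀ j, f (b j) = ∑ i, T i j • b i) ∧ (∀ i j, i < j → T i j = 0) ∧
        (Monotone fun i => ‖T i i‖) ∧ ∀ i, f.HasEigenvalue (T i i) := by
  induction N generalizing V with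
  | zero =>
    have := Module.finrank_zero_iff.1 hN
    exact ⟨Module.Basis.empty V, 0, fun j => j.elim0, fun i => i.elim0, fun i => i.elim0,
      fun i => i.elim0⟩
  | succ N ih =>
    have : Nontrivial V := Module.nontrivial_of_finrank_pos (R := ℂ) (by omega)
    obtain ⟨μ, hμ, hmin⟩ := Set.exists_min_image {μ | f.HasEigenvalue μ} (fun μ => ‖μ‖)
      f.finite_hasEigenvalue (Module.End.exists_eigenvalue f)
    have hlt : LinearMap.range (f - algebraMap ℂ _ μ) < ⊤ := by
      refine lt_top_iff_ne_top.2 fun h => ?_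
      have h1 := (LinearMap.isUnit_iff_range_eq_top _).2 h
      have h2 := Module.End.hasEigenvalue_iff_mem_spectrum.1 hμ
      rw [spectrum.mem_iff] at h2
      exact h2 (by rw [← neg_sub]; exact h1.neg)
    obtain ⟨φ, hφ, hle⟩ := Submodule.exists_le_ker_of_lt_top _ hlt
    have hmem : ∀ v, f v - μ • v ∈ LinearMap.ker φ := fun v => hle ⟨v, by simp⟩
    have hinv : ∀ v ∈ LinearMap.ker φ, f v ∈ LinearMap.ker φ := fun v hv => by
      have := Submodule.add_mem _ (hmem v) (Submodule.smul_mem _ μ hv)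
      rwa [sub_add_cancel] at this
    have hfr : Module.finrank ℂ (LinearMap.ker φ) = N := by
      have := Module.Dual.finrank_ker_add_one_of_ne_zero hφ
      omega
    obtain ⟨b, T, hT, hlow, hmono, heig⟩ := ih hfr (f.restrict hinv)
    have heig' : ∀ i, f.HasEigenvalue (T i i) := fun i => by
      obtain ⟨v, hv⟩ := (heig i).exists_hasEigenvector
      refine Module.End.hasEigenvalue_of_hasEigenvector (x := (v : V)) ⟨?_, ?_⟩
      · rw [Module.End.mem_eigenspace_iff]
        exact congrArg Subtype.val hv.apply_eq_smul
      · simpa using hv.2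
    obtain ⟨y, hy⟩ : ∃ y, φ y ≠ 0 := by
      by_contra! h
      exact hφ (LinearMap.ext h)
    have hli : ∀ (c : ℂ), ∀ v ∈ LinearMap.ker φ, c • y + v = 0 → c = 0 := fun c v hv h => by
      have := congrArg φ h
      rw [map_add, LinearMap.mem_ker.1 hv] at this
      simpa [hy] using this
    have hsp : ∀ z : V, ∃ c : ℂ, z + c • y ∈ LinearMap.ker φ := fun z =>
      ⟨-(φ z / φ y), by simp [hy]⟩
    let d : Fin N → ℂ := fun i => b.repr ⟨_, hmem y⟩ i
    let T' : Matrix (Fin (N + 1)) (Fin (N + 1)) ℂ := Matrix.of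
      (Fin.cons (Fin.cons μ fun _ => 0) fun i => Fin.cons (d i) fun j => T i j)
    refine ⟨Module.Basis.mkFinCons y b hli hsp, T', ?_, ?_, ?_, ?_⟩
    · intro j
      rw [Module.Basis.coe_mkFinCons, Fin.sum_univ_succ]
      refine Fin.cases ?_ (fun j => ?_) j
      · have h1 := congrArg Subtype.val (b.sum_repr ⟨_, hmem y⟩)
        simp only [AddSubmonoidClass.coe_finsetSum, SetLike.val_smul] at h1
        simp only [T', Matrix.of_apply, Fin.cons_zero, Fin.cons_succ, Function.comp_apply, d]
        rw [h1]; abel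
      · have h1 := congrArg Subtype.val (hT j)
        simp only [AddSubmonoidClass.coe_finsetSum, SetLike.val_smul] at h1
        simp only [T', Matrix.of_apply, Fin.cons_zero, Fin.cons_succ, Function.comp_apply,
          zero_smul, zero_add]
        exact h1
    · intro i j
      refine Fin.cases ?_ (fun i => ?_) i <;> refine Fin.cases ?_ (fun j => ?_) j
      · simp
      · simp [T']
      · simp
      · intro h; simpa [T'] using hlow i j (by simpa using h)
    · intro i j
      refine Fin.cases ?_ (fun i => ?_) i <;> refine Fin.cases ?_ (fun j => ?_) j
      · simp
      · intro _; simpa [T'] using hmin _ (heig' j)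
      · simp
      · intro h; simpa [T'] using hmono (by simpa using h)
    · intro i
      refine Fin.cases ?_ (fun i => ?_) i
      · simpa [T'] using hμ
      · simpa [T'] using heig' i

theorem Matrix.exists_sorted_triangularization {N : ℕ} (A : Matrix (Fin N) (Fin N) ℂ) :
    ∃ U V T : Matrix (Fin N) (Fin N) ℂ, U * V = 1 ∧ V * U = 1 ∧ A * U = U * T ∧
      T.IsUpperTriangular ∧ Antitone fun i => ‖T i i‖ := by
  obtain ⟨b, T, hT, hlow, hmono, -⟩ :=
    Module.End.exists_basis_triangular N (by simp) (Matrix.toLin' A)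
  let e := Pi.basisFun ℂ (Fin N)
  -- Reversing the basis turns lower triangular with increasing moduli into upper triangular with
  -- decreasing moduli.
  let b' := b.reindex Fin.revPerm
  refine ⟨e.toMatrix b', b'.toMatrix e, T.submatrix Fin.rev Fin.rev,
    e.toMatrix_mul_toMatrix_flip b', b'.toMatrix_mul_toMatrix_flip e, ?_, ?_, ?_⟩
  · ext i j
    have h1 := congrFun (hT j.rev) i
    rw [Matrix.toLin'_apply] at h1
    simp only [Matrix.mul_apply, Matrix.submatrix_apply, Module.Basis.toMatrix_apply, e, b',
      Pi.basisFun_repr, Module.Basis.reindex_apply, Fin.revPerm_symm, Fin.revPerm_apply]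
    refine h1.trans ?_
    rw [Finset.sum_apply, ← Equiv.sum_comp Fin.revPerm]
    exact Finset.sum_congr rfl fun l _ => by simp [mul_comm]
  · intro i j h
    exact hlow _ _ (Fin.rev_lt_rev.2 h)
  · intro i j h
    exact hmono (Fin.rev_le_rev.2 h)

/-! ### Spectra of strictly totally positive matrices -/

section triangular
open Matrix
variable {R : Type*} [CommRing R] {N p : ℕ} {T : Matrix (Fin N) (Fin N) R}

/-- By pigeonhole every permutation sends some `j ≤ i` to an index at least `i`, and the
corresponding entry lies below the diagonal. The compound is thus triangular for the componentwise
order. -/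
theorem Matrix.IsUpperTriangular.compound_eq_zero (hT : T.IsUpperTriangular)
    {r c : Fin p ↪o Fin N} (h : ∃ i, c i < r i) : T.compound p r c = 0 := by
  obtain ⟨i, hi⟩ := h
  rw [Matrix.compound_apply, Matrix.det_apply']
  refine Finset.sum_eq_zero fun σ _ => ?_
  obtain ⟨j, hj, hσ⟩ : ∃ j ≤ i, i ≤ σ j := by
    by_contra! hall
    have := Finset.card_le_card_of_injOn (s := Finset.Iic i) (t := Finset.Iio i) σ
      (fun j hj => by simpa using hall j (by simpa using hj)) σ.injective.injOn
    simp at this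
  rw [Finset.prod_eq_zero (Finset.mem_univ j), mul_zero]
  exact hT (((c.monotone hj).trans_lt hi).trans_le (r.monotone hσ))

theorem Matrix.IsUpperTriangular.compound_self (hT : T.IsUpperTriangular) (r : Fin p ↪o Fin N) :
    T.compound p r r = ∏ i, T (r i) (r i) := by
  rw [Matrix.compound_apply, Matrix.det_of_isUpperTriangular]
  · rfl
  · exact fun i j h => hT (r.strictMono h)

theorem OrderEmbedding.val_le_apply (r : Fin p ↪o Fin N) (i : Fin p) : (i : ℕ) ≤ r i := by
  obtain ⟨i, hi⟩ := i
  induction i with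
  | zero => simp
  | succ i ih =>
    have h1 := ih (by omega)
    have h2 : r ⟨i, by omega⟩ < r ⟨i + 1, hi⟩ := r.strictMono (by simp)
    have h3 : (r ⟨i, by omega⟩ : ℕ) < r ⟨i + 1, hi⟩ := h2
    exact (Nat.succ_le_succ h1).trans h3

theorem Matrix.IsUpperTriangular.compound_mulVec_leading (hT : T.IsUpperTriangular) (h : p ≤ N) :
    T.compound p *ᵥ Pi.single (Fin.castLEOrderEmb h) 1 =
      (∏ i, T (Fin.castLE h i) (Fin.castLE h i)) • Pi.single (Fin.castLEOrderEmb h) 1 := by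
  ext r
  rw [Matrix.mulVec_single_one, Matrix.col_apply, Pi.smul_apply, smul_eq_mul]
  by_cases hr : r = Fin.castLEOrderEmb h
  · subst hr
    rw [hT.compound_self, Pi.single_eq_same, mul_one]; rfl
  · rw [Pi.single_eq_of_ne hr, mul_zero]
    refine hT.compound_eq_zero ?_
    by_contra! hle
    refine hr (DFunLike.ext _ _ fun i => le_antisymm (hle i) ?_)
    exact r.val_le_apply i

/-- The embedding with image `0, …, q - 1, q + 1`. -/
def Fin.skipEmbedding {q : ℕ} (h : q + 1 < N) : Fin (q + 1) ↪o Fin N :=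
  OrderEmbedding.ofStrictMono
    (fun i => ⟨if (i : ℕ) < q then (i : ℕ) else q + 1, by have := i.2; split_ifs <;> omega⟩)
    fun i j hij => by
      have := j.2
      have hij' : (i : ℕ) < j := hij
      simp only [Fin.lt_def]
      split_ifs <;> omega

theorem Fin.skipEmbedding_val {q : ℕ} (h : q + 1 < N) (i : Fin (q + 1)) :
    (Fin.skipEmbedding h i : ℕ) = if (i : ℕ) < q then (i : ℕ) else q + 1 := rfl

theorem Fin.skipEmbedding_ne {q : ℕ} (h : q + 1 < N) :
    Fin.skipEmbedding h ≠ Fin.castLEOrderEmb h.le := fun he => by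
  have := congrArg Fin.val (DFunLike.congr_fun he (Fin.last q))
  simp [Fin.skipEmbedding_val] at this

/-- Componentwise, only the leading index set and this one itself lie below it. -/
theorem Matrix.IsUpperTriangular.compound_mulVec_skip (hT : T.IsUpperTriangular) {q : ℕ}
    (h : q + 1 < N) :
    T.compound (q + 1) *ᵥ Pi.single (Fin.skipEmbedding h) 1 =
      (∏ i, T (Fin.skipEmbedding h i) (Fin.skipEmbedding h i)) • Pi.single (Fin.skipEmbedding h) 1 +
        T.compound (q + 1) (Fin.castLEOrderEmb h.le) (Fin.skipEmbedding h) •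
          Pi.single (Fin.castLEOrderEmb h.le) 1 := by
  ext r
  rw [Matrix.mulVec_single_one, Matrix.col_apply, Pi.add_apply, Pi.smul_apply, Pi.smul_apply,
    smul_eq_mul, smul_eq_mul]
  by_cases hr : r = Fin.skipEmbedding h
  · subst hr
    rw [hT.compound_self, Pi.single_eq_same, Pi.single_eq_of_ne (Fin.skipEmbedding_ne h)]
    simp
  by_cases hr' : r = Fin.castLEOrderEmb h.le
  · subst hr'
    rw [Pi.single_eq_of_ne (Fin.skipEmbedding_ne h).symm]
    simp
  · rw [Pi.single_eq_of_ne hr, Pi.single_eq_of_ne hr', mul_zero, mul_zero, add_zero]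
    refine hT.compound_eq_zero ?_
    by_contra! hle
    have hle' : ∀ i : Fin (q + 1), (r i : ℕ) ≤ if (i : ℕ) < q then (i : ℕ) else q + 1 := hle
    have hge := r.val_le_apply
    have hlast := hle' (Fin.last q)
    have hlast' := hge (Fin.last q)
    simp only [Fin.val_last, lt_irrefl, if_false] at hlast hlast'
    rcases (show (r (Fin.last q) : ℕ) = q ∨ (r (Fin.last q) : ℕ) = q + 1 by omega) with he | he
    · refine hr' (DFunLike.ext _ _ fun i => Fin.ext ?_)
      change (r i : ℕ) = i
      rcases lt_or_ge (i : ℕ) q with hi | hi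
      · have := hle' i; rw [if_pos hi] at this; have := hge i; omega
      · obtain rfl : i = Fin.last q := Fin.ext (by have := i.2; simp; omega)
        simpa using he
    · refine hr (DFunLike.ext _ _ fun i => Fin.ext ?_)
      rw [Fin.skipEmbedding_val]
      rcases lt_or_ge (i : ℕ) q with hi | hi
      · have := hle' i; rw [if_pos hi] at this ⊢; have := hge i; omega
      · obtain rfl : i = Fin.last q := Fin.ext (by have := i.2; simp; omega)
        simpa using he

end triangular

section spectrum
variable {N : ℕ} {B : Matrix (Fin N) (Fin N) ℝ} {U V T : Matrix (Fin N) (Fin N) ℂ}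

open Matrix

/-- The Perron eigenvalue is a diagonal entry of the compound of `T`, so the leading product, of
largest modulus among these, has modulus at least `ρ`; being an eigenvalue, it equals `ρ`. The last
clause transports simplicity to `T`. -/
theorem Matrix.IsStrictlyTotallyPos.exists_leading_prod_eq (hB : B.IsStrictlyTotallyPos)
    (hUV : U * V = 1) (hVU : V * U = 1) (hBU : B.map Complex.ofReal * U = U * T)
    (hT : T.IsUpperTriangular) (hanti : Antitone fun i => ‖T i i‖) {p : ℕ} (h : p ≤ N) :
    ∃ ρ : ℝ, 0 < ρ ∧ ∏ i, T (Fin.castLE h i) (Fin.castLE h i) = ρ ∧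
      ∀ (v v' : (Fin p ↪o Fin N) → ℂ) (γ : ℂ), v ≠ 0 → T.compound p *ᵥ v = (ρ : ℂ) • v →
        T.compound p *ᵥ v' = (ρ : ℂ) • v' + γ • v → ∃ a : ℂ, v' = a • v := by
  have : Nonempty (Fin p ↪o Fin N) := ⟨Fin.castLEOrderEmb h⟩
  obtain ⟨ρ, hρ, ⟨w, hw, hBw⟩, hdom, huniq⟩ :=
    Matrix.exists_perron_eigenvalue (P := B.compound p) fun r c => hB p r c
  have hmap : (B.map Complex.ofReal).compound p = (B.compound p).map Complex.ofReal :=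
    Matrix.compound_map Complex.ofRealHom p B
  have hUV' : U.compound p * V.compound p = 1 := by
    rw [← Matrix.compound_mul, hUV, Matrix.compound_one]
  have hVU' : V.compound p * U.compound p = 1 := by
    rw [← Matrix.compound_mul, hVU, Matrix.compound_one]
  have hcomp : (B.compound p).map Complex.ofReal * U.compound p = U.compound p * T.compound p := by
    rw [← hmap, ← Matrix.compound_mul, hBU, Matrix.compound_mul]
  have hact : ∀ v, (B.compound p).map Complex.ofReal *ᵥ (U.compound p *ᵥ v) =
      U.compound p *ᵥ (T.compound p *ᵥ v) := fun v => by
    rw [Matrix.mulVec_mulVec, hcomp, ← Matrix.mulVec_mulVec]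
  have hinj : ∀ v v', U.compound p *ᵥ v = U.compound p *ᵥ v' → v = v' := fun v v' he => by
    have := congrArg (V.compound p *ᵥ ·) he
    simpa [Matrix.mulVec_mulVec, hVU'] using this
  have hne : ∀ v, v ≠ 0 → U.compound p *ᵥ v ≠ 0 := fun v hv he =>
    hv (hinj v 0 (by rw [he, Matrix.mulVec_zero]))
  obtain ⟨z, rfl⟩ : ∃ z, w = U.compound p *ᵥ z :=
    ⟨V.compound p *ᵥ w, by rw [Matrix.mulVec_mulVec, hUV', Matrix.one_mulVec]⟩
  have hz : z ≠ 0 := by rintro rfl; exact hw (Matrix.mulVec_zero _)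
  have hTz : T.compound p *ᵥ z = (ρ : ℂ) • z := hinj _ _ (by
    rw [← hact, hBw, Matrix.mulVec_smul])
  -- At an index set of largest sum in the support of the eigenvector, triangularity leaves only the
  -- diagonal term.
  obtain ⟨r, hr⟩ : ∃ r : Fin p ↪o Fin N, (ρ : ℂ) = ∏ i, T (r i) (r i) := by
    obtain ⟨r, hr, hmax⟩ := Finset.exists_max_image (Finset.univ.filter fun r => z r ≠ 0)
      (fun r : Fin p ↪o Fin N => ∑ i, (r i : ℕ)) (by
        obtain ⟨r, hr⟩ := Function.ne_iff.1 hz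
        exact ⟨r, by simpa using hr⟩)
    have hr' : z r ≠ 0 := by simpa using hr
    refine ⟨r, mul_right_cancel₀ hr' ?_⟩
    rw [← hT.compound_self, ← smul_eq_mul, ← Pi.smul_apply, ← hTz]
    refine Finset.sum_eq_single_of_mem r (Finset.mem_univ r) fun c _ hc => ?_
    by_cases hzc : z c = 0
    · simp [hzc]
    suffices h0 : T.compound p r c = 0 by simp [h0]
    refine hT.compound_eq_zero ?_
    by_contra! hle
    have h1 := hmax c (by simpa using hzc)
    have h2 : ∑ i, (r i : ℕ) < ∑ i, (c i : ℕ) := by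
      refine Finset.sum_lt_sum (fun i _ => hle i) ?_
      by_contra! hall
      exact hc (DFunLike.ext _ _ fun i => le_antisymm (hall i (Finset.mem_univ i)) (hle i))
    omega
  have hlead := hT.compound_mulVec_leading h
  set Λ := ∏ i, T (Fin.castLE h i) (Fin.castLE h i) with hΛ
  have hle : ρ ≤ ‖Λ‖ := by
    have h1 : ρ = ‖(ρ : ℂ)‖ := by rw [Complex.norm_real, Real.norm_of_nonneg hρ.le]
    rw [h1, hr, hΛ, norm_prod, norm_prod]
    exact Finset.prod_le_prod (fun i _ => norm_nonneg _) fun i _ =>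
      hanti (show Fin.castLE h i ≤ r i from r.val_le_apply i)
  refine ⟨ρ, hρ, hdom Λ _ (hne (Pi.single (Fin.castLEOrderEmb h) 1) (by simp)) ?_ hle, ?_⟩
  · rw [hact, hlead, Matrix.mulVec_smul]
  · intro v v' γ hv h1 h2
    obtain ⟨a, ha⟩ := huniq _ _ γ (hne v hv) (by rw [hact, h1, Matrix.mulVec_smul])
      (show _ = (ρ : ℂ) • (U.compound p *ᵥ v') + _ by
        rw [hact, h2, Matrix.mulVec_add, Matrix.mulVec_smul, Matrix.mulVec_smul])
    exact ⟨a, hinj _ _ (by rw [ha, Matrix.mulVec_smul])⟩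

/-- Diagonal entries are quotients of consecutive leading products. If two neighbours were equal,
the leading and the skipping basis vectors would span a two-dimensional generalized eigenspace for
the Perron eigenvalue. -/
theorem Matrix.IsStrictlyTotallyPos.triangular_diag (hB : B.IsStrictlyTotallyPos)
    (hUV : U * V = 1) (hVU : V * U = 1) (hBU : B.map Complex.ofReal * U = U * T)
    (hT : T.IsUpperTriangular) (hanti : Antitone fun i => ‖T i i‖) :
    (∀ i, ∃ l : ℝ, 0 < l ∧ T i i = l) ∧ StrictAnti fun i => ‖T i i‖ := by
  have hlead := fun (p : ℕ) (h : p ≤ N) =>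
    hB.exists_leading_prod_eq hUV hVU hBU hT hanti h
  have hpos : ∀ i, ∃ l : ℝ, 0 < l ∧ T i i = l := by
    intro i
    obtain ⟨ρ, hρ, h1, -⟩ := hlead i i.2.le
    obtain ⟨ρ', hρ', h2, -⟩ := hlead (i + 1) i.2
    rw [Fin.prod_univ_castSucc] at h2
    have h3 : (ρ : ℂ) * T i i = ρ' := by rw [← h1, ← h2]; rfl
    refine ⟨ρ' / ρ, div_pos hρ' hρ, ?_⟩
    have : (ρ : ℂ) ≠ 0 := by exact_mod_cast hρ.ne'
    push_cast
    rw [← h3, mul_div_cancel_left₀ _ this]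
  refine ⟨hpos, fun i j hij => ?_⟩
  obtain ⟨q, hq⟩ := i
  have hq1 : q + 1 < N := lt_of_le_of_lt (show q + 1 ≤ j from hij) j.2
  have h1 : ‖T j j‖ ≤ ‖T ⟨q + 1, hq1⟩ ⟨q + 1, hq1⟩‖ := hanti (show _ ≤ j from hij)
  refine h1.trans_lt (lt_of_le_of_ne (hanti (show (⟨q, hq⟩ : Fin N) ≤ ⟨q + 1, hq1⟩ by simp)) ?_)
  intro he
  replace he : ‖T ⟨q + 1, hq1⟩ ⟨q + 1, hq1⟩‖ = ‖T ⟨q, hq⟩ ⟨q, hq⟩‖ := he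
  have heq : T ⟨q + 1, hq1⟩ ⟨q + 1, hq1⟩ = T ⟨q, hq⟩ ⟨q, hq⟩ := by
    obtain ⟨l, hl, hl'⟩ := hpos ⟨q, hq⟩
    obtain ⟨m, hm, hm'⟩ := hpos ⟨q + 1, hq1⟩
    simp only [hl', hm', Complex.norm_real, Real.norm_of_nonneg hl.le,
      Real.norm_of_nonneg hm.le] at he ⊢
    rw [he]
  obtain ⟨ρ, hρ, hΛ, huniq⟩ := hlead (q + 1) hq1.le
  have h2 := hT.compound_mulVec_leading hq1.le
  have h3 := hT.compound_mulVec_skip hq1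
  have hΛ' : ∏ i, T (Fin.skipEmbedding hq1 i) (Fin.skipEmbedding hq1 i) = ρ := by
    rw [← hΛ, Fin.prod_univ_castSucc, Fin.prod_univ_castSucc]
    congr 1
    · refine Finset.prod_congr rfl fun i _ => ?_
      have : Fin.skipEmbedding hq1 i.castSucc = Fin.castLE hq1.le i.castSucc :=
        Fin.ext (by simp [Fin.skipEmbedding_val])
      rw [this]
    · have : Fin.skipEmbedding hq1 (Fin.last q) = ⟨q + 1, hq1⟩ :=
        Fin.ext (by simp [Fin.skipEmbedding_val])
      rw [this, heq]; rfl
  rw [hΛ] at h2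
  rw [hΛ'] at h3
  obtain ⟨a, ha⟩ := huniq _ _ _ (by simp) h2 h3
  have := congrFun ha (Fin.skipEmbedding hq1)
  rw [Pi.single_eq_same, Pi.smul_apply, Pi.single_eq_of_ne (Fin.skipEmbedding_ne hq1)] at this
  simp at this

/-- If all large powers of a real matrix are strictly totally positive, its eigenvalues are
positive and simple. -/
theorem Matrix.exists_charpoly_eq_of_pow_isStrictlyTotallyPos {A : Matrix (Fin N) (Fin N) ℝ}
    {m : ℕ} (h1 : (A ^ m).IsStrictlyTotallyPos) (h2 : (A ^ (m + 1)).IsStrictlyTotallyPos) :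
    ∃ ev : Fin N → ℝ, StrictAnti ev ∧ (∀ i, 0 < ev i) ∧
      A.charpoly = ∏ i, (X - C (ev i)) := by
  obtain ⟨U, V, T, hUV, hVU, hAU, hT, hanti⟩ :=
    Matrix.exists_sorted_triangularization (A.map Complex.ofReal)
  have hmapPow : ∀ m : ℕ, (A ^ m).map Complex.ofReal = A.map Complex.ofReal ^ m := fun m =>
    Matrix.map_pow A Complex.ofRealHom m
  have hpow : ∀ m : ℕ, (A ^ m).map Complex.ofReal * U = U * T ^ m := by
    intro m
    rw [hmapPow]
    induction m with
    | zero => simp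
    | succ m ih => rw [pow_succ', mul_assoc, ih, ← mul_assoc, hAU, mul_assoc, ← pow_succ']
  have hdiag : ∀ (m : ℕ) (i : Fin N), (T ^ m) i i = T i i ^ m := by
    intro m i
    induction m with
    | zero => simp
    | succ m ih =>
      rw [pow_succ, Matrix.mul_apply, Finset.sum_eq_single i, ih, pow_succ]
      · intro j _ hj
        rcases hj.lt_or_gt with h | h
        · rw [hT.pow m h, zero_mul]
        · rw [hT h, mul_zero]
      · simp
  have hanti' : ∀ m : ℕ, Antitone fun i => ‖(T ^ m) i i‖ := fun m i j hij => by
    simp only [hdiag, norm_pow]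
    exact pow_le_pow_left₀ (norm_nonneg _) (hanti hij) m
  obtain ⟨p1, s1⟩ := h1.triangular_diag hUV hVU (hpow m) (hT.pow m) (hanti' m)
  obtain ⟨p2, -⟩ := h2.triangular_diag hUV hVU (hpow _) (hT.pow _) (hanti' _)
  -- One power determines an eigenvalue only up to a root of unity; the quotient of consecutive
  -- powers is the eigenvalue itself.
  have hpos : ∀ i, ∃ l : ℝ, 0 < l ∧ T i i = l := fun i => by
    obtain ⟨a, ha, ha'⟩ := p1 i
    obtain ⟨b, hb, hb'⟩ := p2 i
    rw [hdiag] at ha' hb'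
    refine ⟨b / a, div_pos hb ha, ?_⟩
    have : (a : ℂ) ≠ 0 := by exact_mod_cast ha.ne'
    push_cast
    rw [← hb', ← ha', pow_succ, mul_div_cancel_left₀ _ (ha' ▸ this)]
  choose ev hev hT' using hpos
  refine ⟨ev, fun i j hij => ?_, hev, ?_⟩
  · have := s1 hij
    simp only [hdiag, hT', norm_pow, Complex.norm_real, Real.norm_of_nonneg (hev _).le] at this
    exact lt_of_pow_lt_pow_left₀ m (hev i).le this
  · have hc := Matrix.charpoly_of_isUpperTriangular T hT
    have hc' : T.charpoly = (A.map Complex.ofReal).charpoly := by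
      have hU : T = V * (A.map Complex.ofReal * U) := by rw [hAU, ← mul_assoc, hVU, one_mul]
      rw [hU, Matrix.charpoly_mul_comm, mul_assoc, hUV, mul_one]
    rw [hc'] at hc
    have hm : (A.map Complex.ofReal).charpoly = A.charpoly.map Complex.ofRealHom :=
      Matrix.charpoly_map A Complex.ofRealHom
    refine Polynomial.map_injective Complex.ofRealHom Complex.ofRealHom.injective ?_
    rw [← hm, hc, Polynomial.map_prod]
    refine Finset.prod_congr rfl fun i _ => ?_
    simp [hT']

theorem Matrix.spectrum_map_ofReal {A : Matrix (Fin N) (Fin N) ℝ} {ev : Fin N → ℝ}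
    (h : A.charpoly = ∏ i, (X - C (ev i))) :
    spectrum ℂ (A.map Complex.ofReal) = Set.range fun i => (ev i : ℂ) := by
  have hm : (A.map Complex.ofReal).charpoly = A.charpoly.map Complex.ofRealHom :=
    Matrix.charpoly_map A Complex.ofRealHom
  ext z
  rw [Matrix.mem_spectrum_iff_isRoot_charpoly, hm, h, Polynomial.map_prod, Polynomial.IsRoot,
    Polynomial.eval_prod, Finset.prod_eq_zero_iff]
  simp [sub_eq_zero, eq_comm]

end spectrum

end

theorem mainTheorem5 (n k : ℕ) (hn : 0 < n) (hk : 0 < k) (x : ℤ → ℝ)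
    (hx : IsExtendedKnotSequence n k x) :
    (collocationMatrix n k x).IsOscillatory ∧
      ∃ ev : Fin (n + k) → ℝ, StrictAnti ev ∧ (∀ i, 0 < ev i) ∧
        (collocationMatrix n k x).charpoly = ∏ i, (X - C (ev i)) ∧
        spectrum ℂ ((collocationMatrix n k x).map Complex.ofReal) =
          Set.range fun i => (ev i : ℂ) := by
  rw [← collocationMatrix_clampKnots]
  have hx' := hx.clampKnots
  have hm := hx.clampKnots_monotone
  have hA := hx'.collocationMatrix_isTotallyNonneg hm hn
  have hpow := fun (m : ℕ) (h : n + k ≤ m) => hA.pow_isStrictlyTotallyPos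
    (fun p r c => hx'.collocationMatrix_minor_pos hm hn hk r c) h
  obtain ⟨ev, hanti, hpos, hev⟩ := Matrix.exists_charpoly_eq_of_pow_isStrictlyTotallyPos
    (hpow (n + k) le_rfl) (hpow (n + k + 1) (Nat.le_succ _))
  exact ⟨⟨hA, n + k, by omega, hpow _ le_rfl⟩, ev, hanti, hpos, hev,
    Matrix.spectrum_map_ofReal hev⟩
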